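/- For $m\ge 1$ write a permutation of $[m]=\{1,\dots,m\}$ as a word $\sigma=\sigma_1\cdots\sigma_m$. A descent of $\sigma$ is a pair $(\sigma_i,\sigma_{i+1})$ with $\sigma_i>\sigma_{i+1}$; then $\sigma_i$ is called a descent top and $\sigma_{i+1}$ a descent bottom. A permutation $\sigma$ of $[2n]$ is an $\mathcal E$-permutation if every descent has an even top and an odd bottom, and for no $j\in\{1,\dots,n\}$ the entries $2j-1$ and $2j$ are simultaneously a descent bottom and a descent top of $\sigma$, respectively. Let $\overline{\mathcal X}_{2n}$ be the set of $\mathcal E$-permutations of $[2n]$. Let $\mathrm{des}\,\sigma$ be the number of descents of $\sigma$; let $\mathrm{lema}\,\sigma$ (resp. $\mathrm{loma}\,\sigma$) be the number of even (resp. odd) left-to-right maxima, i.e. of even (resp. odd) values $\sigma_i$ with $\sigma_j<\sigma_i$ for all $j<i$; let $\mathrm{les}\,\sigma$ be the number of pairs $(i,j)$ with $2\le i<j\le m$ and $\sigma_{i-1}>\sigma_j>\sigma_i$; and let $\mathrm{res}\,\sigma$ be the number of pairs $(i,j)$ with $1\le i<j\le m-1$ and $\sigma_j>\sigma_i>\sigma_{j+1}$.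 For $n\ge 1$ put $$[x,n]_{p,q}=x\,p^{n-1}+\sum_{i=1}^{n-1}p^{n-1-i}q^i,\qquad [n]_{p,q}=[1,n]_{p,q}.$$ Then, as formal power series in $x$ over $\mathbb Z[a,\bar a,p,q,t]$ (hence also for any values of $a,\bar a,p,q,t$ in a commutative ring), $$1+\sum_{n\ge 1}\ \sum_{\sigma\in\overline{\mathcal X}_{2n}}a^{\mathrm{lema}\,\sigma}\,\bar a^{\,\mathrm{loma}\,\sigma}\,p^{\mathrm{res}\,\sigma}\,q^{\mathrm{les}\,\sigma}\,t^{\mathrm{des}\,\sigma}\,x^n =\cfrac{1}{1-b_0x-\cfrac{\lambda_1x^2}{1-b_1x-\cfrac{\lambda_2x^2}{1-b_2x-\cdots}}}$$ where, for all $n\ge 1$, $$b_{n-1}=[a,n]_{p,q}\,[\bar a,n]_{p,q},\qquad \lambda_n=t\,[a,n]_{p,q}\,[a,n+1]_{p,q}\,[n]_{p,q}\,[\bar a,n+1]_{p,q}.$$ The infinite continued fraction denotes the coefficientwise limit of its finite truncations (each coefficient is eventually constant). -/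

import Mathlib

/-! Permutations of `[m] = {1, …, m}` are elements of `Equiv.Perm (Fin m)`; the letter in position
`i` of the word of `σ` is `letter σ i = σ i + 1`. -/

namespace EPermJFrac

/-- The letter (an element of `{1, …, m}`) of the word of `σ` at position `i`. -/
def letter {m : ℕ} (σ : Equiv.Perm (Fin m)) (i : Fin m) : ℕ := (σ i : ℕ) + 1

/-- `i`, `j` are consecutive positions and the letters there form a descent pair. -/
abbrev IsDescentAt {m : ℕ} (σ : Equiv.Perm (Fin m)) (i j : Fin m) : Prop :=
  (i : ℕ) + 1 = (j : ℕ) ∧ letter σ j < letter σ i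

/-- The number of descents. -/
def des {m : ℕ} (σ : Equiv.Perm (Fin m)) : ℕ :=
  (Finset.univ.filter fun i : Fin m => ∃ j : Fin m, IsDescentAt σ i j).card

/-- The letter `v` is a descent top of `σ`. -/
abbrev IsDescentTop {m : ℕ} (σ : Equiv.Perm (Fin m)) (v : ℕ) : Prop :=
  ∃ i j : Fin m, IsDescentAt σ i j ∧ letter σ i = v

/-- The letter `v` is a descent bottom of `σ`. -/
abbrev IsDescentBottom {m : ℕ} (σ : Equiv.Perm (Fin m)) (v : ℕ) : Prop :=
  ∃ i j : Fin m, IsDescentAt σ i j ∧ letter σ j = v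

/-- All descents have an even top and an odd bottom. -/
abbrev IsEvenOddDescentPerm {m : ℕ} (σ : Equiv.Perm (Fin m)) : Prop :=
  ∀ i j : Fin m, IsDescentAt σ i j → Even (letter σ i) ∧ Odd (letter σ j)

/-- An `𝓔`-permutation of `[2n]`: an even-odd descent permutation such that for no `j ∈ [n]` the
letters `2j-1` and `2j` are simultaneously a descent bottom and a descent top. -/
abbrev IsEPerm {n : ℕ} (σ : Equiv.Perm (Fin (2 * n))) : Prop :=
  IsEvenOddDescentPerm σ ∧
    ∀ j ∈ Finset.Icc 1 n, ¬ (IsDescentBottom σ (2 * j - 1) ∧ IsDescentTop σ (2 * j))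

/-- The letter at position `i` is a left-to-right maximum. -/
abbrev IsLRMax {m : ℕ} (σ : Equiv.Perm (Fin m)) (i : Fin m) : Prop :=
  ∀ j : Fin m, j < i → letter σ j < letter σ i

/-- The number of even left-to-right maxima. -/
def lema {m : ℕ} (σ : Equiv.Perm (Fin m)) : ℕ :=
  (Finset.univ.filter fun i : Fin m => IsLRMax σ i ∧ Even (letter σ i)).card

/-- The number of odd left-to-right maxima. -/
def loma {m : ℕ} (σ : Equiv.Perm (Fin m)) : ℕ :=
  (Finset.univ.filter fun i : Fin m => IsLRMax σ i ∧ Odd (letter σ i)).card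

/-- The number of pairs `(i, j)` with `2 ≤ i < j ≤ m` and `σ_{i-1} > σ_j > σ_i`;
`k` is the position `i - 1`. -/
def les {m : ℕ} (σ : Equiv.Perm (Fin m)) : ℕ :=
  (Finset.univ.filter fun x : Fin m × Fin m =>
    x.1 < x.2 ∧ ∃ k : Fin m, (k : ℕ) + 1 = (x.1 : ℕ) ∧
      letter σ x.2 < letter σ k ∧ letter σ x.1 < letter σ x.2).card

/-- The number of pairs `(i, j)` with `1 ≤ i < j ≤ m - 1` and `σ_j > σ_i > σ_{j+1}`;
`k` is the position `j + 1`. -/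
def res {m : ℕ} (σ : Equiv.Perm (Fin m)) : ℕ :=
  (Finset.univ.filter fun x : Fin m × Fin m =>
    x.1 < x.2 ∧ ∃ k : Fin m, (x.2 : ℕ) + 1 = (k : ℕ) ∧
      letter σ x.1 < letter σ x.2 ∧ letter σ k < letter σ x.1).card

section Ring

variable {R : Type*} [CommRing R]

/-- The sum over `𝓔`-permutations `σ` of `[2n]` of
`a ^ lema σ * abar ^ loma σ * p ^ res σ * q ^ les σ * t ^ des σ`. -/
def ePoly (a abar p q t : R) (n : ℕ) : R :=
  ∑ σ : Equiv.Perm (Fin (2 * n)) with IsEPerm σ,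
    a ^ lema σ * abar ^ loma σ * p ^ res σ * q ^ les σ * t ^ des σ

/-- `[x, n]_{p,q} = x p^{n-1} + ∑_{i=1}^{n-1} p^{n-1-i} q^i`, meant for `n ≥ 1`. -/
def pqBracket (p q x : R) (n : ℕ) : R :=
  x * p ^ (n - 1) + ∑ i ∈ Finset.Ico 1 n, p ^ (n - 1 - i) * q ^ i

/-- `jConv b lam k s` is the finite continued fraction with `k` levels
`1 / (1 - b_s x - lam_{s+1} x² / (1 - b_{s+1} x - ⋯ / (1 - b_{s+k-1} x)))`
as a formal power series in `x`. -/
noncomputable def jConv (b lam : ℕ → R) : ℕ → ℕ → PowerSeries R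
  | 0, _ => 0
  | k + 1, s =>
      PowerSeries.invOfUnit
        (1 - PowerSeries.C (b s) * PowerSeries.X
          - PowerSeries.C (lam (s + 1)) * PowerSeries.X ^ 2 * jConv b lam k (s + 1)) 1

/-- The inverse taken in `jConv` is a genuine one. -/
theorem jConv_succ_spec (b lam : ℕ → R) (k s : ℕ) :
    (1 - PowerSeries.C (b s) * PowerSeries.X
      - PowerSeries.C (lam (s + 1)) * PowerSeries.X ^ 2 * jConv b lam k (s + 1))
      * jConv b lam (k + 1) s = 1 := by
  rw [jConv]
  exact PowerSeries.mul_invOfUnit _ 1 (by simp)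

/-- `F` is the infinite J-fraction
`1 / (1 - b_0 x - lam_1 x² / (1 - b_1 x - lam_2 x² / (1 - b_2 x - ⋯)))`:
the convergents tend to `F` coefficientwise, each coefficient being eventually constant. -/
def IsJFraction (F : PowerSeries R) (b lam : ℕ → R) : Prop :=
  ∀ m : ℕ, ∀ᶠ k in Filter.atTop,
    PowerSeries.coeff m (jConv b lam k 0) = PowerSeries.coeff m F

end Ring

end EPermJFrac

/-! A permutation is built by adding the letters 1, 2, … in increasing order while a height h
follows a Motzkin path. For a threshold v, keep the letters at most v, replace each maximal run of
larger letters that is followed by a kept letter by one placeholder M, and drop a final run of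
larger letters. Each M is then the top of a descent whose bottom is already placed, so no two M's
are adjacent and M is never last; taking M even lets the even-odd condition apply to these descents
as well (`IsGood`). The height h is the number of M's.

The letter v + 1 enters in one of three ways. If it is neither a descent bottom nor a descent top,
it goes just before an M or at the end, h + 1 places in all (`goodSum_level`). If it is a bottom,
hence odd, the pair M, v + 1 is put in one of these places and creates a descent, of weight t
(`goodSum_up`). If it is a top, hence even, it replaces an M (`goodSum_down`). As the middle letter
of 2-31 or 31-2 it meets exactly the descents from an M: a factor p for each M on its right and q
for each M on its left, apart from the M inserted or replaced with it. Unless it is a bottom, it is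
a left-to-right maximum exactly when no M is on its left. Summing over the places gives the brackets
with x = a, abar or 1.

The letters 2j+1 and 2j+2 together form one step of the path. The condition on 𝓔-permutations
forbids exactly "up, then down", so a level step at height h has weight [a,h+1][abar,h+1], an up
step from h has weight t[1,h+1][a,h+2], and a down step to h has weight [abar,h+2][a,h+1]
(`goodSum_even_succ`, `goodSum_eq_motzkin`). Flajolet's theorem (`isJFraction_of_coeff_eq_motzkin`)
then yields the continued fraction. -/

namespace EPermJFrac

/-! ### Weighted Motzkin paths and J-fractions -/

section MotzkinPaths

variable {R : Type*} [CommRing R]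

/-- The weighted number of Motzkin paths with `n` steps from height `0` to height `h`; a level step
at height `i` has weight `b i`, a step from `i` to `i + 1` has weight `up i`, and a step from
`i + 1` to `i` has weight `down i`. -/
def motzkin (b up down : ℕ → R) : ℕ → ℕ → R
  | 0, h => if h = 0 then 1 else 0
  | n + 1, 0 => b 0 * motzkin b up down n 0 + down 0 * motzkin b up down n 1
  | n + 1, h + 1 => up h * motzkin b up down n h + b (h + 1) * motzkin b up down n (h + 1)
      + down (h + 1) * motzkin b up down n (h + 2)

/-- The generating function, by length, of the Motzkin paths from height `0` to height `h` that stay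
below height `K`. -/
noncomputable def motzkinSeries (b lam up : ℕ → R) (K : ℕ) : ℕ → PowerSeries R
  | 0 => jConv b lam K 0
  | h + 1 => PowerSeries.C (up h) * PowerSeries.X * jConv b lam (K - (h + 1)) (h + 1)
      * motzkinSeries b lam up K h

/-- The product formula for the series cuts a path at its last step from each height to the next.
Multiplying out the denominator of the continued fraction turns it into the recursion on the last
step of a path, here and in `motzkinSeries_succ_eq`. -/
theorem motzkinSeries_zero_eq {b lam up down : ℕ → R} (hlam : ∀ h, lam (h + 1) = up h * down h)
    {K : ℕ} (hK : 0 < K) :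
    motzkinSeries b lam up K 0 = 1 + (PowerSeries.C (b 0) * motzkinSeries b lam up K 0
      + PowerSeries.C (down 0) * motzkinSeries b lam up K 1) * PowerSeries.X := by
  obtain ⟨k, rfl⟩ := Nat.exists_eq_add_of_lt hK
  have h := jConv_succ_spec b lam k 0
  simp only [motzkinSeries, zero_add, Nat.add_sub_cancel] at h ⊢
  have h1 := hlam 0
  simp only [zero_add] at h1
  rw [h1, map_mul] at h
  linear_combination h

theorem motzkinSeries_succ_eq {b lam up down : ℕ → R} (hlam : ∀ h, lam (h + 1) = up h * down h)
    {K h : ℕ} (hK : h + 1 < K) :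
    motzkinSeries b lam up K (h + 1) = (PowerSeries.C (up h) * motzkinSeries b lam up K h
      + PowerSeries.C (b (h + 1)) * motzkinSeries b lam up K (h + 1)
      + PowerSeries.C (down (h + 1)) * motzkinSeries b lam up K (h + 2)) * PowerSeries.X := by
  obtain ⟨k, rfl⟩ := Nat.exists_eq_add_of_lt hK
  have h0 := jConv_succ_spec b lam k (h + 1)
  rw [hlam (h + 1), map_mul] at h0
  have e1 : h + 1 + k + 1 - (h + 1) = k + 1 := by omega
  have e2 : h + 1 + k + 1 - (h + 1 + 1) = k := by omega
  simp only [motzkinSeries, e1, e2]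
  linear_combination PowerSeries.C (up h) * PowerSeries.X
    * motzkinSeries b lam up (h + 1 + k + 1) h * h0

/-- A path of length n ending at height h never exceeds (n + h) / 2, so the bound K is not felt; n +
h does not grow along the recursion. -/
theorem coeff_motzkinSeries {b lam up down : ℕ → R} (hlam : ∀ h, lam (h + 1) = up h * down h)
    {K : ℕ} (n h : ℕ) (hK : n + h < K) :
    PowerSeries.coeff n (motzkinSeries b lam up K h) = motzkin b up down n h := by
  induction n generalizing h with
  | zero =>
    cases h with
    | zero => rw [motzkinSeries_zero_eq hlam (by omega)]; simp [motzkin]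
    | succ h => rw [motzkinSeries_succ_eq hlam (by omega)]; simp [motzkin]
  | succ n ih =>
    cases h with
    | zero =>
      rw [motzkinSeries_zero_eq hlam (by omega), map_add, PowerSeries.coeff_succ_mul_X]
      simp [motzkin, PowerSeries.coeff_one, ih 0 (by omega), ih 1 (by omega)]
    | succ h =>
      rw [motzkinSeries_succ_eq hlam (by omega), PowerSeries.coeff_succ_mul_X]
      simp [motzkin, ih h (by omega), ih (h + 1) (by omega), ih (h + 2) (by omega)]

/-- Flajolet's theorem: the J-fraction enumerates weighted Motzkin paths. -/
theorem isJFraction_of_coeff_eq_motzkin {b lam up down : ℕ → R}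
    (hlam : ∀ h, lam (h + 1) = up h * down h) {F : PowerSeries R}
    (hF : ∀ n, PowerSeries.coeff n F = motzkin b up down n 0) : IsJFraction F b lam := by
  intro m
  filter_upwards [Filter.eventually_gt_atTop m] with k hk
  rw [hF, ← coeff_motzkinSeries hlam m 0 hk, motzkinSeries]

end MotzkinPaths

/-! ### Statistics of words and their change when v + 1 is inserted -/

section Words

/-- The number of adjacent pairs of letters of a word that are related by `r`. -/
def adjCount (r : ℕ → ℕ → Prop) [DecidableRel r] : List ℕ → ℕ
  | [] => 0
  | [_] => 0
  | a :: b :: w => (if r a b then 1 else 0) + adjCount r (b :: w)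

/-- The number of descents of a word. -/
def wordDes (w : List ℕ) : ℕ := adjCount (fun a b => b < a) w

/-- The number of occurrences of the pattern `2-31`. -/
def wordRes : List ℕ → ℕ
  | [] => 0
  | c :: w => adjCount (fun a b => b < c ∧ c < a) w + wordRes w

/-- The number of occurrences of the pattern `31-2`. -/
def wordLes : List ℕ → ℕ
  | [] => 0
  | [_] => 0
  | a :: b :: w => w.countP (fun c => b < c ∧ c < a) + wordLes (b :: w)

/-- The number of left-to-right maxima that exceed `B` and satisfy `P`. -/
def lrMaxCount (P : ℕ → Prop) [DecidablePred P] : ℕ → List ℕ → ℕ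
  | _, [] => 0
  | B, a :: w => (if B < a ∧ P a then 1 else 0) + lrMaxCount P (max B a) w

/-- Letters at most `v`, and the letter `M`. -/
abbrev IsLetter (v M c : ℕ) : Prop := c ≤ v ∨ c = M

variable {v M : ℕ}

/-- The relations to be counted hold only on descents or on the pair (M, M), so the ascents around v
+ 1 are invisible. With r abstract, one lemma serves descents, straddling pairs, bad pairs and the
conditions on single letters. -/
theorem adjCount_level (r : ℕ → ℕ → Prop) [DecidableRel r] (h₁ : ∀ a ≤ v, ¬ r a (v + 1))
    (h₂ : ∀ a ≤ v, ¬ r a M) (h₃ : ¬ r (v + 1) M) {x y : List ℕ} (hx : ∀ c ∈ x.getLast?, c ≤ v)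
    (hy : ∀ c ∈ y.head?, c = M) :
    adjCount r (x ++ (v + 1) :: y) = adjCount r (x ++ y) := by
  induction x with
  | nil =>
    cases y with
    | nil => simp [adjCount]
    | cons d y => simp at hy; subst hy; simp [adjCount, h₃]
  | cons a x ih =>
    cases x with
    | nil =>
      simp at hx
      cases y with
      | nil => simp [adjCount, h₁ a hx]
      | cons d y => simp at hy; subst hy; simp [adjCount, h₁ a hx, h₂ a hx, h₃]
    | cons b x =>
      have := ih (by simpa using hx)
      simp only [List.cons_append] at this
      simp [adjCount, this]

theorem adjCount_up (r : ℕ → ℕ → Prop) [DecidableRel r]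
    (h₂ : ∀ a ≤ v, ¬ r a M) (h₃ : ¬ r (v + 1) M) {x y : List ℕ} (hx : ∀ c ∈ x.getLast?, c ≤ v)
    (hy : ∀ c ∈ y.head?, c = M) :
    adjCount r (x ++ M :: (v + 1) :: y)
      = adjCount r (x ++ y) + if r M (v + 1) then 1 else 0 := by
  induction x with
  | nil =>
    cases y with
    | nil => simp [adjCount]
    | cons d y => simp at hy; subst hy; simp [adjCount, h₃, add_comm]
  | cons a x ih =>
    cases x with
    | nil =>
      simp at hx
      cases y with
      | nil => simp [adjCount, h₂ a hx]
      | cons d y => simp at hy; subst hy; simp [adjCount, h₂ a hx, h₃, add_comm]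
    | cons b x =>
      have := ih (by simpa using hx)
      simp only [List.cons_append] at this
      simp [adjCount, this, add_assoc]

theorem adjCount_down (r : ℕ → ℕ → Prop) [DecidableRel r] (h₁ : ∀ a ≤ v, ¬ r a (v + 1))
    (h₂ : ∀ a ≤ v, ¬ r a M) (h₃ : ∀ c ≤ v, r (v + 1) c ↔ r M c) {x y : List ℕ}
    (hx : ∀ c ∈ x.getLast?, c ≤ v) (hy : ∀ c ∈ y.head?, c ≤ v) :
    adjCount r (x ++ (v + 1) :: y) = adjCount r (x ++ M :: y) := by
  induction x with
  | nil =>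
    cases y with
    | nil => simp [adjCount]
    | cons d y => simp at hy; simp [adjCount, h₃ d hy]
  | cons a x ih =>
    cases x with
    | nil =>
      simp at hx
      cases y with
      | nil => simp [adjCount, h₁ a hx, h₂ a hx]
      | cons d y => simp at hy; simp [adjCount, h₁ a hx, h₂ a hx, h₃ d hy]
    | cons b x =>
      have := ih (by simpa using hx)
      simp only [List.cons_append] at this
      simp [adjCount, this]

/-- `M` is isolated in the word: it does not occur twice in a row, and is not the last letter. -/
abbrev Isolated (M : ℕ) (w : List ℕ) : Prop :=
  adjCount (fun a b => a = M ∧ b = M) w = 0 ∧ M ∉ w.getLast?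

theorem Isolated.of_cons {a b : ℕ} {w : List ℕ} (h : Isolated M (a :: b :: w)) :
    Isolated M (b :: w) := by
  simp only [Isolated, adjCount] at h ⊢
  exact ⟨by omega, by simpa using h.2⟩

theorem Isolated.ne_or_ne {a b : ℕ} {w : List ℕ} (h : Isolated M (a :: b :: w)) :
    a ≠ M ∨ b ≠ M := by
  by_contra! hc
  simp [Isolated, adjCount, hc] at h

/-- The number of adjacent pairs straddling `v + 1` is the number of `M`'s. -/
theorem adjCount_straddle_succ (hM : v + 1 < M) {w : List ℕ} (hw : ∀ c ∈ w, IsLetter v M c)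
    (h : Isolated M w) :
    adjCount (fun a b => b < v + 1 ∧ v + 1 < a) w = w.count M := by
  induction w with
  | nil => simp [adjCount]
  | cons a w ih =>
    cases w with
    | nil =>
      have : a ≠ M := by simpa [eq_comm] using h.2
      simp [adjCount, this]
    | cons b w =>
      have h1 := h.ne_or_ne
      have ha := hw a (by simp)
      have hb := hw b (by simp)
      rw [adjCount, ih (fun c hc => hw c (by simp [hc])) h.of_cons, List.count_cons (a := M) (b := a),
        add_comm]
      congr 1
      simp only [beq_iff_eq]
      congr 1
      apply propext
      simp only [IsLetter] at ha hb
      omega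

theorem adjCount_straddle_eq_zero {d : ℕ} {l : List ℕ} (hl : ∀ c ∈ l, c ≤ d) :
    adjCount (fun a b => b < d ∧ d < a) l = 0 := by
  induction l with
  | nil => rfl
  | cons a l ih =>
    cases l with
    | nil => rfl
    | cons b l =>
      have := hl a (by simp)
      rw [adjCount, ih (fun c hc => hl c (by simp [hc])), if_neg (by omega)]

/-- Surrounded by ascents, v + 1 takes no part in any 31. As the 2 it meets one descent for each M
of y, because each such M is followed by a letter at most v. -/
theorem wordRes_level (hM : v + 1 < M) {x y : List ℕ} (hxl : ∀ c ∈ x, IsLetter v M c)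
    (hx : ∀ c ∈ x.getLast?, c ≤ v)
    (hy : ∀ c ∈ y.head?, c = M) (hyl : ∀ c ∈ y, IsLetter v M c) (hyi : Isolated M y) :
    wordRes (x ++ (v + 1) :: y) = wordRes (x ++ y) + y.count M := by
  induction x with
  | nil => simp only [List.nil_append, wordRes, adjCount_straddle_succ hM hyl hyi, add_comm]
  | cons d x ih =>
    have hx' : ∀ c ∈ x.getLast?, c ≤ v := by
      cases x with
      | nil => simp
      | cons b x => simpa using hx
    have hd := hxl d (by simp)
    simp only [IsLetter] at hd
    rw [List.cons_append, List.cons_append, wordRes, wordRes,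
      ih (fun c hc => hxl c (by simp [hc])) hx', adjCount_level _ _ _ _ hx' hy]
    · ring
    all_goals omega

/-- No letter lies strictly between v + 1 and M, so the new descent is never the 31 of a pattern;
and M is never the 2, since nothing exceeds it. -/
theorem wordRes_up (hM : v + 1 < M) {x y : List ℕ} (hxl : ∀ c ∈ x, IsLetter v M c)
    (hx : ∀ c ∈ x.getLast?, c ≤ v)
    (hy : ∀ c ∈ y.head?, c = M) (hyl : ∀ c ∈ y, IsLetter v M c) (hyi : Isolated M y) :
    wordRes (x ++ M :: (v + 1) :: y) = wordRes (x ++ y) + y.count M := by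
  have key : ∀ (d : ℕ) (x : List ℕ), IsLetter v M d → (∀ c ∈ x.getLast?, c ≤ v) →
      adjCount (fun a b => b < d ∧ d < a) (x ++ M :: (v + 1) :: y)
      = adjCount (fun a b => b < d ∧ d < a) (x ++ y) := by
    intro d x hd hx'
    simp only [IsLetter] at hd
    rw [adjCount_up _ _ _ hx' hy, if_neg, add_zero]
    all_goals omega
  induction x with
  | nil =>
    have h2 : adjCount (fun a b => b < M ∧ M < a) ((v + 1) :: y) = 0 := by
      apply adjCount_straddle_eq_zero
      intro c hc
      rcases List.mem_cons.1 hc with rfl | hc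
      · omega
      · have := hyl c hc
        simp only [IsLetter] at this
        omega
    simp only [List.nil_append, wordRes, adjCount_straddle_succ hM hyl hyi, h2]
    omega
  | cons d x ih =>
    have hx' : ∀ c ∈ x.getLast?, c ≤ v := by
      cases x with
      | nil => simp
      | cons b x => simpa using hx
    have hd := hxl d (by simp)
    rw [List.cons_append, List.cons_append, wordRes, wordRes,
      ih (fun c hc => hxl c (by simp [hc])) hx', key d x hd hx']
    ring

/-- As the 3 of a pattern, v + 1 does what M did in its place; the gain comes from its new role as
the 2. -/
theorem wordRes_down (hM : v + 1 < M) {x y : List ℕ} (hxl : ∀ c ∈ x, IsLetter v M c)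
    (hx : ∀ c ∈ x.getLast?, c ≤ v)
    (hy : ∀ c ∈ y.head?, c ≤ v) (hyl : ∀ c ∈ y, IsLetter v M c) (hyi : Isolated M y) :
    wordRes (x ++ (v + 1) :: y) = wordRes (x ++ M :: y) + y.count M := by
  induction x with
  | nil =>
    rw [List.nil_append, List.nil_append, wordRes, wordRes, adjCount_straddle_succ hM hyl hyi,
      adjCount_straddle_eq_zero (d := M)]
    · omega
    · intro c hc
      have := hyl c hc
      simp only [IsLetter] at this
      omega
  | cons d x ih =>
    have hx' : ∀ c ∈ x.getLast?, c ≤ v := by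
      cases x with
      | nil => simp
      | cons b x => simpa using hx
    have hd := hxl d (by simp)
    simp only [IsLetter] at hd
    rw [List.cons_append, List.cons_append, wordRes, wordRes,
      ih (fun c hc => hxl c (by simp [hc])) hx', adjCount_down _ _ _ _ hx' hy]
    · ring
    all_goals omega

theorem wordLes_succ_cons (hM : v + 1 < M) {y : List ℕ} (hy : ∀ c ∈ y.head?, c = M) :
    wordLes ((v + 1) :: y) = wordLes y := by
  cases y with
  | nil => simp [wordLes]
  | cons d y =>
    simp at hy; subst hy
    simp only [wordLes, Nat.add_eq_right, List.countP_eq_zero, decide_eq_true_eq]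
    omega

/-- The mirror count: isolation of M in x makes each M of x start a descent inside x that straddles
v + 1. -/
theorem wordLes_level (hM : v + 1 < M) {x y : List ℕ} (hxl : ∀ c ∈ x, IsLetter v M c)
    (hxi : Isolated M x) (hy : ∀ c ∈ y.head?, c = M) :
    wordLes (x ++ (v + 1) :: y) = wordLes (x ++ y) + x.count M := by
  induction x with
  | nil => simp [wordLes_succ_cons hM hy]
  | cons a x ih =>
    have ha := hxl a (by simp)
    cases x with
    | nil =>
      have h1 : a ≠ M := by simpa [eq_comm] using hxi.2
      have h2 : a ≤ v := by simp only [IsLetter] at ha; omega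
      rw [List.singleton_append, List.singleton_append, wordLes, wordLes_succ_cons hM hy,
        List.countP_eq_zero.2]
      · cases y with
        | nil => simp [wordLes, h1]
        | cons d y =>
          simp at hy; subst hy
          simp only [wordLes, List.count_singleton, beq_iff_eq, h1, if_false, zero_add, add_zero,
            Nat.right_eq_add, List.countP_eq_zero, decide_eq_true_eq]
          omega
      · simp only [decide_eq_true_eq]; omega
    | cons b x =>
      have := ih (fun c hc => hxl c (by simp [hc])) hxi.of_cons
      simp only [List.cons_append] at this
      have hb := hxl b (by simp)
      have h1 := hxi.ne_or_ne
      simp only [List.cons_append, wordLes, this, List.countP_append, List.countP_cons,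
        List.count_cons (a := M) (b := a), decide_eq_true_eq, beq_iff_eq]
      have h2 : (b < v + 1 ∧ v + 1 < a) ↔ a = M := by simp only [IsLetter] at ha hb; omega
      simp only [h2]
      ring

theorem wordLes_up (hM : v + 1 < M) {x y : List ℕ} (hxl : ∀ c ∈ x, IsLetter v M c)
    (hyl : ∀ c ∈ y, IsLetter v M c)
    (hxi : Isolated M x) (hy : ∀ c ∈ y.head?, c = M) :
    wordLes (x ++ M :: (v + 1) :: y) = wordLes (x ++ y) + x.count M := by
  have h0 : wordLes (M :: (v + 1) :: y) = wordLes y := by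
    rw [wordLes, wordLes_succ_cons hM hy, Nat.add_eq_right, List.countP_eq_zero]
    intro c hc
    have := hyl c hc
    simp only [IsLetter] at this
    simp only [decide_eq_true_eq]
    omega
  induction x with
  | nil => simp [h0]
  | cons a x ih =>
    have ha := hxl a (by simp)
    cases x with
    | nil =>
      have h1 : a ≠ M := by simpa [eq_comm] using hxi.2
      have h2 : a ≤ v := by simp only [IsLetter] at ha; omega
      rw [List.singleton_append, List.singleton_append, wordLes, h0, List.countP_eq_zero.2]
      · cases y with
        | nil => simp [wordLes, h1]
        | cons d y =>
          simp at hy; subst hy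
          simp only [wordLes, List.count_singleton, beq_iff_eq, h1, if_false, zero_add, add_zero,
            Nat.right_eq_add, List.countP_eq_zero, decide_eq_true_eq]
          omega
      · simp only [decide_eq_true_eq]; omega
    | cons b x =>
      have := ih (fun c hc => hxl c (by simp [hc])) hxi.of_cons
      simp only [List.cons_append] at this
      have hb := hxl b (by simp)
      have h1 := hxi.ne_or_ne
      simp only [List.cons_append, wordLes, this, List.countP_append, List.countP_cons,
        List.count_cons (a := M) (b := a), decide_eq_true_eq, beq_iff_eq]
      have h2 : (b < v + 1 ∧ v + 1 < a) ↔ a = M := by simp only [IsLetter] at ha hb; omega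
      have h3 : ¬ (b < M ∧ M < a) := by simp only [IsLetter] at ha hb; omega
      simp only [h2, h3, if_false]
      ring

theorem wordLes_down (hM : v + 1 < M) {x y : List ℕ} (hxl : ∀ c ∈ x, IsLetter v M c)
    (hyl : ∀ c ∈ y, IsLetter v M c)
    (hxi : Isolated M x) :
    wordLes (x ++ (v + 1) :: y) = wordLes (x ++ M :: y) + x.count M := by
  have h0 : wordLes ((v + 1) :: y) = wordLes (M :: y) := by
    cases y with
    | nil => simp [wordLes]
    | cons d y =>
      simp only [wordLes]
      congr 1
      apply List.countP_congr
      intro c hc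
      have := hyl c (by simp [hc])
      simp only [IsLetter] at this
      simp only [decide_eq_true_eq]
      omega
  induction x with
  | nil => simp [h0]
  | cons a x ih =>
    have ha := hxl a (by simp)
    cases x with
    | nil =>
      have h1 : a ≠ M := by simpa [eq_comm] using hxi.2
      have h2 : a ≤ v := by simp only [IsLetter] at ha; omega
      rw [List.singleton_append, List.singleton_append, wordLes, wordLes, h0,
        List.countP_eq_zero.2, List.countP_eq_zero.2]
      · simp [h1]
      all_goals simp only [decide_eq_true_eq]; omega
    | cons b x =>
      have := ih (fun c hc => hxl c (by simp [hc])) hxi.of_cons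
      simp only [List.cons_append] at this
      have hb := hxl b (by simp)
      have h1 := hxi.ne_or_ne
      simp only [List.cons_append, wordLes, this, List.countP_append, List.countP_cons,
        List.count_cons (a := M) (b := a), decide_eq_true_eq, beq_iff_eq]
      have h2 : (b < v + 1 ∧ v + 1 < a) ↔ a = M := by simp only [IsLetter] at ha hb; omega
      have h3 : ¬ (b < M ∧ M < a) := by simp only [IsLetter] at ha hb; omega
      simp only [h2, h3, if_false]
      ring

theorem lrMaxCount_eq_zero (P : ℕ → Prop) [DecidablePred P] {B : ℕ} {w : List ℕ}
    (h : ∀ c ∈ w, c ≤ B ∨ ¬ P c) : lrMaxCount P B w = 0 := by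
  induction w generalizing B with
  | nil => rfl
  | cons a w ih =>
    rw [lrMaxCount, ih, if_neg]
    · have := h a (by simp)
      rintro ⟨h1, h2⟩
      exact this.elim h1.not_ge (fun h3 => h3 h2)
    · intro c hc
      exact (h c (by simp [hc])).imp (fun h1 => h1.trans (le_max_left _ _)) id

/-- An M in x hides everything after it. Without one, the running maximum after x is still at most
v, and the local change e is what is seen. -/
theorem lrMaxCount_append_of_eq_add (P : ℕ → Prop) [DecidablePred P] {B : ℕ}
    {x y z : List ℕ} {e : ℕ} (hxl : ∀ c ∈ x, IsLetter v M c) (hvM : v < M)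
    (hz : ∀ c ∈ z, c ≤ M) (hy : ∀ c ∈ y, c ≤ M)
    (hB : B ≤ v) (h : ∀ B ≤ v, lrMaxCount P B z = lrMaxCount P B y + e) :
    lrMaxCount P B (x ++ z) = lrMaxCount P B (x ++ y) + if x.count M = 0 then e else 0 := by
  induction x generalizing B with
  | nil => simp [h B hB]
  | cons a x ih =>
    have ha := hxl a (by simp)
    have hx' : ∀ c ∈ x, IsLetter v M c := fun c hc => hxl c (by simp [hc])
    rw [List.cons_append, List.cons_append, lrMaxCount, lrMaxCount]
    rcases ha with ha | rfl
    · have : a ≠ M := by omega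
      rw [ih hx' (max_le hB ha), List.count_cons_of_ne this, add_assoc]
    · have hx'' : ∀ c ∈ x, c ≤ a := fun c hc => by
        have := hx' c hc
        simp only [IsLetter] at this
        omega
      rw [lrMaxCount_eq_zero, lrMaxCount_eq_zero]
      · simp
      · intro c hc
        rcases List.mem_append.1 hc with hc | hc
        · have := hx'' c hc; omega
        · have := hy c hc; omega
      · intro c hc
        rcases List.mem_append.1 hc with hc | hc
        · have := hx'' c hc; omega
        · have := hz c hc; omega

end Words

/-! ### Insertion and the descent conditions -/

section Insertion

variable {v M : ℕ}

theorem adjCount_eq_zero_iff_isChain (r : ℕ → ℕ → Prop) [DecidableRel r] (w : List ℕ) :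
    adjCount r w = 0 ↔ w.IsChain fun a b => ¬ r a b := by
  induction w with
  | nil => simp [adjCount]
  | cons a w ih =>
    cases w with
    | nil => simp [adjCount]
    | cons b w => simp [adjCount, ih]

theorem adjCount_append_eq_zero (r : ℕ → ℕ → Prop) [DecidableRel r] (x y : List ℕ) :
    adjCount r (x ++ y) = 0 ↔ adjCount r x = 0 ∧ adjCount r y = 0 ∧
      ∀ a ∈ x.getLast?, ∀ b ∈ y.head?, ¬ r a b := by
  simp only [adjCount_eq_zero_iff_isChain, List.isChain_append]

theorem adjCount_eq_zero_of_forall (r : ℕ → ℕ → Prop) [DecidableRel r] {w : List ℕ}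
    (h : ∀ a ∈ w, ∀ b ∈ w.tail, ¬ r a b) : adjCount r w = 0 := by
  induction w with
  | nil => rfl
  | cons a w ih =>
    cases w with
    | nil => rfl
    | cons b w =>
      rw [adjCount, if_neg (h a (by simp) b (by simp)), ih]
      intro c hc d hd
      exact h c (by simp [hc]) d (by simpa using List.mem_of_mem_tail hd)

/-- The letter `u` is not a descent bottom of the word. -/
abbrev NoBottom (u : ℕ) (w : List ℕ) : Prop := adjCount (fun a b => b = u ∧ u < a) w = 0

/-- The letter `u` is not a descent top of the word. -/
abbrev NoTop (u : ℕ) (w : List ℕ) : Prop := adjCount (fun a b => a = u ∧ b < u) w = 0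

theorem noBottom_iff {u : ℕ} {x y : List ℕ} (hx : u ∉ x) (hy : u ∉ y) :
    NoBottom u (x ++ u :: y) ↔ ∀ c ∈ x.getLast?, c ≤ u := by
  rw [NoBottom, adjCount_append_eq_zero]
  refine ⟨fun h c hc => ?_, fun h => ⟨?_, ?_, ?_⟩⟩
  · simpa using h.2.2 c hc
  · exact adjCount_eq_zero_of_forall _ fun a _ b hb h => hx (h.1 ▸ List.mem_of_mem_tail hb)
  · exact adjCount_eq_zero_of_forall _ fun a _ b hb h => hy (h.1 ▸ hb)
  · intro a ha b hb
    have := h a ha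
    omega

theorem noTop_iff {u : ℕ} {x y : List ℕ} (hx : u ∉ x) (hy : u ∉ y) :
    NoTop u (x ++ u :: y) ↔ ∀ c ∈ y.head?, u ≤ c := by
  rw [NoTop, List.append_cons, adjCount_append_eq_zero]
  refine ⟨fun h c hc => ?_, fun h => ⟨?_, ?_, ?_⟩⟩
  · simpa using h.2.2 u (by simp) c hc
  · rw [adjCount_append_eq_zero]
    refine ⟨adjCount_eq_zero_of_forall _ fun a ha b _ h => hx (h.1 ▸ ha), rfl, ?_⟩
    intro a ha b hb h
    exact hx (h.1 ▸ List.mem_of_getLast? ha)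
  · exact adjCount_eq_zero_of_forall _ fun a ha b _ h => hy (h.1 ▸ ha)
  · intro a ha b hb
    have := h b hb
    omega

/-- The pairs that may not be adjacent: descents which are not even-odd, and two letters `M`. -/
abbrev BadPair (M a b : ℕ) : Prop := (b < a ∧ ¬ (Even a ∧ Odd b)) ∨ (a = M ∧ b = M)

/-- Words in which all descents have even top and odd bottom, and `M` is isolated. -/
abbrev IsGood (M : ℕ) (w : List ℕ) : Prop := adjCount (BadPair M) w = 0 ∧ M ∉ w.getLast?

theorem IsGood.adjCount_isolated {w : List ℕ} (h : adjCount (BadPair M) w = 0) :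
    adjCount (fun a b => a = M ∧ b = M) w = 0 := by
  rw [adjCount_eq_zero_iff_isChain] at h ⊢
  exact h.imp fun a b hab hc => hab (Or.inr hc)

theorem IsGood.isolated_right {x y : List ℕ} (h : IsGood M (x ++ y)) : Isolated M y := by
  refine ⟨IsGood.adjCount_isolated ((adjCount_append_eq_zero _ _ _).1 h.1).2.1, ?_⟩
  intro hm
  apply h.2
  rw [List.getLast?_append, Option.mem_def.1 hm]
  rfl

theorem IsGood.isolated_left {x y : List ℕ} (hM : v < M) (h : IsGood M (x ++ y))
    (hx : ∀ c ∈ x.getLast?, c ≤ v) : Isolated M x :=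
  ⟨IsGood.adjCount_isolated ((adjCount_append_eq_zero _ _ _).1 h.1).1,
    fun hm => by have := hx M hm; omega⟩

theorem isGood_level (hM : v + 1 < M) {x y : List ℕ}
    (hx : ∀ c ∈ x.getLast?, c ≤ v) (hy : ∀ c ∈ y.head?, c = M) :
    IsGood M (x ++ (v + 1) :: y) ↔ IsGood M (x ++ y) := by
  have h1 : ¬ BadPair M (v + 1) M := by simp only [BadPair]; omega
  have h2 : ∀ a ≤ v, ¬ BadPair M a (v + 1) := fun a ha => by simp only [BadPair]; omega
  have h3 : ∀ a ≤ v, ¬ BadPair M a M := fun a ha => by simp only [BadPair]; omega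
  rw [IsGood, IsGood, adjCount_level _ h2 h3 h1 hx hy]
  cases y with
  | nil =>
    have h4 : M ∉ x.getLast? := fun h => by have := hx M h; omega
    have h5 : v + 1 ≠ M := by omega
    simpa [h5] using fun _ => h4
  | cons d y => simp [List.getLast?_append]

theorem isGood_up (hM : v + 1 < M) (hMe : Even M) (hv : Odd (v + 1)) {x y : List ℕ}
    (hx : ∀ c ∈ x.getLast?, c ≤ v) (hy : ∀ c ∈ y.head?, c = M) :
    IsGood M (x ++ M :: (v + 1) :: y) ↔ IsGood M (x ++ y) := by
  have h1 : ¬ BadPair M (v + 1) M := by simp only [BadPair]; omega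
  have h2 : ¬ BadPair M M (v + 1) := by
    rintro (h | h)
    · exact h.2 ⟨hMe, hv⟩
    · omega
  have h3 : ∀ a ≤ v, ¬ BadPair M a M := fun a ha => by simp only [BadPair]; omega
  rw [IsGood, IsGood, adjCount_up _ h3 h1 hx hy, if_neg h2]
  cases y with
  | nil =>
    have h4 : M ∉ x.getLast? := fun h => by have := hx M h; omega
    have h5 : v + 1 ≠ M := by omega
    simpa [h5] using fun _ => h4
  | cons d y => simp [List.getLast?_append]

/-- Both letters are even and exceed v, so they form bad pairs with the same letters at most v.
Nonemptiness of y is needed because v + 1 may be last while M may not. -/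
theorem isGood_down (hM : v + 1 < M) (hMe : Even M) (hv : Even (v + 1)) {x y : List ℕ}
    (hx : ∀ c ∈ x.getLast?, c ≤ v) (hy : ∀ c ∈ y.head?, c ≤ v) (hne : y ≠ []) :
    IsGood M (x ++ (v + 1) :: y) ↔ IsGood M (x ++ M :: y) := by
  have h1 : ∀ c ≤ v, (BadPair M (v + 1) c ↔ BadPair M M c) := fun c hc => by
    have h1 : c < v + 1 := by omega
    have h2 : c < M := by omega
    have h3 : c ≠ M := by omega
    simp only [BadPair, hv, hMe, h1, h2, h3, true_and, and_false, or_false]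
  have h2 : ∀ a ≤ v, ¬ BadPair M a (v + 1) := fun a ha => by simp only [BadPair]; omega
  have h3 : ∀ a ≤ v, ¬ BadPair M a M := fun a ha => by simp only [BadPair]; omega
  rw [IsGood, IsGood, adjCount_down _ h2 h3 h1 hx hy]
  cases y with
  | nil => exact absurd rfl hne
  | cons d y => simp [List.getLast?_append]

/-- An M at the end of x would be either the last letter of the word or next to another M. -/
theorem IsGood.getLast_le {x y : List ℕ} (hxl : ∀ c ∈ x, IsLetter v M c)
    (h : IsGood M (x ++ y)) (hy : ∀ c ∈ y.head?, c = M) : ∀ c ∈ x.getLast?, c ≤ v := by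
  intro c hc
  rcases hxl c (List.mem_of_getLast? hc) with h1 | rfl
  · exact h1
  · cases y with
    | nil => exact absurd hc (by simpa using h.2)
    | cons d y =>
      exact absurd (Or.inr ⟨rfl, hy d (by simp)⟩)
        (((adjCount_append_eq_zero _ _ _).1 h.1).2.2 c hc d (by simp))

theorem IsGood.head_le {x y : List ℕ} (hyl : ∀ c ∈ y, IsLetter v M c)
    (h : IsGood M (x ++ M :: y)) : ∀ c ∈ y.head?, c ≤ v := by
  intro c hc
  rcases hyl c (List.mem_of_head? hc) with h1 | rfl
  · exact h1
  · rw [List.append_cons] at h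
    exact absurd (Or.inr ⟨rfl, rfl⟩)
      (((adjCount_append_eq_zero _ _ _).1 h.1).2.2 c (by simp) c hc)

end Insertion

/-! ### The weight gained by one insertion -/

section Weight

variable {R : Type*} [CommRing R] {v M : ℕ}

/-- The weight of a word. -/
def wordWeight (a abar p q t : R) (M : ℕ) (w : List ℕ) : R :=
  a ^ lrMaxCount (fun c => Even c ∧ c < M) 0 w * abar ^ lrMaxCount (fun c => Odd c ∧ c < M) 0 w
    * p ^ wordRes w * q ^ wordLes w * t ^ wordDes w

theorem le_of_isLetter (hM : v + 1 < M) {w : List ℕ} (h : ∀ c ∈ w, IsLetter v M c) :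
    ∀ c ∈ w, c ≤ M := fun c hc => by
  have := h c hc
  simp only [IsLetter] at this
  omega

/-- Nothing in y counts, before or after: it is empty or opens with an uncounted M that dominates
the rest. -/
theorem lrMaxCount_level (P : ℕ → Prop) [DecidablePred P] (hP : ¬ P M) (hM : v + 1 < M)
    {x y : List ℕ} (hxl : ∀ c ∈ x, IsLetter v M c) (hyl : ∀ c ∈ y, IsLetter v M c)
    (hy : ∀ c ∈ y.head?, c = M) :
    lrMaxCount P 0 (x ++ (v + 1) :: y) = lrMaxCount P 0 (x ++ y)
      + if x.count M = 0 then if P (v + 1) then 1 else 0 else 0 := by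
  have hyM := le_of_isLetter hM hyl
  refine lrMaxCount_append_of_eq_add P hxl (by omega) ?_ hyM (Nat.zero_le _) fun B hB => ?_
  · simpa using ⟨hM.le, hyM⟩
  · have h0 : lrMaxCount P B y = 0 := by
      cases y with
      | nil => rfl
      | cons d y =>
        obtain rfl : d = M := by simpa using hy
        rw [lrMaxCount, if_neg (fun h => hP h.2), lrMaxCount_eq_zero]
        exact fun c hc => Or.inl ((hyM c (by simp [hc])).trans (le_max_right _ _))
    rw [lrMaxCount, lrMaxCount_eq_zero, h0, add_zero, zero_add]
    · exact if_congr ⟨fun h => h.2, fun h => ⟨by omega, h⟩⟩ rfl rfl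
    · intro c hc
      rcases hyl c hc with h | rfl
      · exact Or.inl (h.trans (by omega))
      · exact Or.inr hP

theorem lrMaxCount_up (P : ℕ → Prop) [DecidablePred P] (hP : ¬ P M) (hM : v + 1 < M)
    {x y : List ℕ} (hxl : ∀ c ∈ x, IsLetter v M c) (hyl : ∀ c ∈ y, IsLetter v M c)
    (hy : ∀ c ∈ y.head?, c = M) :
    lrMaxCount P 0 (x ++ M :: (v + 1) :: y) = lrMaxCount P 0 (x ++ y) := by
  have hyM := le_of_isLetter hM hyl
  have := lrMaxCount_append_of_eq_add P (B := 0) (e := 0) (z := M :: (v + 1) :: y) hxl (by omega) ?_ hyM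
    (Nat.zero_le _) fun B hB => ?_
  · simpa using this
  · simpa using ⟨hM.le, hyM⟩
  · rw [lrMaxCount, if_neg (fun h => hP h.2), lrMaxCount_eq_zero]
    · cases y with
      | nil => rfl
      | cons d y =>
        obtain rfl : d = M := by simpa using hy
        rw [lrMaxCount, if_neg (fun h => hP h.2), lrMaxCount_eq_zero]
        exact fun c hc => Or.inl ((hyM c (by simp [hc])).trans (le_max_right _ _))
    · intro c hc
      refine Or.inl (le_trans ?_ (le_max_right _ _))
      rcases List.mem_cons.1 hc with rfl | hc
      · omega
      · exact hyM c hc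

theorem lrMaxCount_down (P : ℕ → Prop) [DecidablePred P] (hP : ¬ P M) (hM : v + 1 < M)
    {x y : List ℕ} (hxl : ∀ c ∈ x, IsLetter v M c) (hyl : ∀ c ∈ y, IsLetter v M c) :
    lrMaxCount P 0 (x ++ (v + 1) :: y) = lrMaxCount P 0 (x ++ M :: y)
      + if x.count M = 0 then if P (v + 1) then 1 else 0 else 0 := by
  have hyM := le_of_isLetter hM hyl
  refine lrMaxCount_append_of_eq_add P hxl (by omega) ?_ ?_ (Nat.zero_le _) fun B hB => ?_
  · simpa using ⟨hM.le, hyM⟩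
  · simpa using hyM
  · have h0 : lrMaxCount P B (M :: y) = 0 := by
      rw [lrMaxCount, if_neg (fun h => hP h.2), lrMaxCount_eq_zero]
      exact fun c hc => Or.inl ((hyM c hc).trans (le_max_right _ _))
    rw [h0, lrMaxCount, lrMaxCount_eq_zero, add_zero, zero_add]
    · exact if_congr ⟨fun h => h.2, fun h => ⟨by omega, h⟩⟩ rfl rfl
    · intro c hc
      rcases hyl c hc with h | rfl
      · exact Or.inl (h.trans (by omega))
      · exact Or.inr hP

theorem wordWeight_level (a abar p q t : R) (hM : v + 1 < M)
    {x y : List ℕ} (hxl : ∀ c ∈ x, IsLetter v M c) (hyl : ∀ c ∈ y, IsLetter v M c)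
    (hy : ∀ c ∈ y.head?, c = M) (h : IsGood M (x ++ y)) :
    wordWeight a abar p q t M (x ++ (v + 1) :: y)
      = (if x.count M = 0 then if Even (v + 1) then a else abar else 1)
        * p ^ y.count M * q ^ x.count M * wordWeight a abar p q t M (x ++ y) := by
  have hx := h.getLast_le hxl hy
  have hdes : wordDes (x ++ (v + 1) :: y) = wordDes (x ++ y) :=
    adjCount_level _ (by omega) (by omega) (by omega) hx hy
  rw [wordWeight, wordWeight, wordRes_level hM hxl hx hy hyl h.isolated_right,
    wordLes_level hM hxl (h.isolated_left (by omega) hx) hy, hdes,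
    lrMaxCount_level _ (by simp) hM hxl hyl hy, lrMaxCount_level _ (by simp) hM hxl hyl hy]
  simp only [pow_add]
  by_cases h0 : x.count M = 0
  · by_cases hv : Even (v + 1)
    · have : ¬ Odd (v + 1) := by simpa using hv
      simp only [h0, hv, this, hM, if_true, and_true, if_false, pow_one, pow_zero]
      ring
    · have : Odd (v + 1) := by simpa using hv
      simp only [h0, hv, this, hM, if_true, and_true, if_false, pow_one, pow_zero]
      ring
  · simp only [h0, if_false, pow_zero]
    ring

theorem wordWeight_up (a abar p q t : R) (hM : v + 1 < M)
    {x y : List ℕ} (hxl : ∀ c ∈ x, IsLetter v M c) (hyl : ∀ c ∈ y, IsLetter v M c)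
    (hy : ∀ c ∈ y.head?, c = M) (h : IsGood M (x ++ y)) :
    wordWeight a abar p q t M (x ++ M :: (v + 1) :: y)
      = t * p ^ y.count M * q ^ x.count M * wordWeight a abar p q t M (x ++ y) := by
  have hx := h.getLast_le hxl hy
  have hdes : wordDes (x ++ M :: (v + 1) :: y) = wordDes (x ++ y) + 1 := by
    rw [wordDes, adjCount_up _ (by omega) (by omega) hx hy, if_pos hM, wordDes]
  rw [wordWeight, wordWeight, wordRes_up hM hxl hx hy hyl h.isolated_right,
    wordLes_up hM hxl hyl (h.isolated_left (by omega) hx) hy, hdes,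
    lrMaxCount_up _ (by simp) hM hxl hyl hy, lrMaxCount_up _ (by simp) hM hxl hyl hy]
  ring

theorem wordWeight_down (a abar p q t : R) (hM : v + 1 < M) (hv : Even (v + 1))
    {x y : List ℕ} (hxl : ∀ c ∈ x, IsLetter v M c) (hyl : ∀ c ∈ y, IsLetter v M c)
    (h : IsGood M (x ++ M :: y)) :
    wordWeight a abar p q t M (x ++ (v + 1) :: y)
      = (if x.count M = 0 then a else 1)
        * p ^ y.count M * q ^ x.count M * wordWeight a abar p q t M (x ++ M :: y) := by
  have hx := h.getLast_le hxl (by simp)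
  have hy := h.head_le hyl
  have hdes : wordDes (x ++ (v + 1) :: y) = wordDes (x ++ M :: y) :=
    adjCount_down _ (by omega) (by omega) (by omega) hx hy
  have hyi : Isolated M y := by
    rw [List.append_cons] at h
    exact h.isolated_right
  have hodd : ¬ Odd (v + 1) := by simpa using hv
  rw [wordWeight, wordWeight, wordRes_down hM hxl hx hy hyl hyi,
    wordLes_down hM hxl hyl (h.isolated_left (by omega) hx), hdes,
    lrMaxCount_down _ (by simp) hM hxl hyl, lrMaxCount_down _ (by simp) hM hxl hyl]
  simp only [pow_add, hv, hodd, hM, if_true, and_true, if_false]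
  by_cases h0 : x.count M = 0
  · simp only [h0, if_true, pow_one, pow_zero]
    ring
  · simp only [h0, if_false, ite_self, pow_zero]
    ring

end Weight

/-! ### Places of insertion, indexed by the number of M's to the left -/

section Cuts

/-- Prepending a letter to the left part of a cut word. -/
def consLeft (a : ℕ) : List ℕ × List ℕ ↪ List ℕ × List ℕ :=
  ⟨fun z => (a :: z.1, z.2), fun z z' h => by
    simp only [Prod.mk.injEq, List.cons.injEq, true_and] at h
    exact Prod.ext h.1 h.2⟩

theorem consLeft_apply (a : ℕ) (z : List ℕ × List ℕ) : consLeft a z = (a :: z.1, z.2) := rfl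

/-- The ways to cut a word in two parts, the second of which is empty or starts with `M`. -/
def cuts (M : ℕ) : List ℕ → Finset (List ℕ × List ℕ)
  | [] => {([], [])}
  | a :: w => (cuts M w).map (consLeft a) ∪ if a = M then {([], a :: w)} else ∅

/-- The ways to write a word as `x ++ M :: y`. -/
def marks (M : ℕ) : List ℕ → Finset (List ℕ × List ℕ)
  | [] => ∅
  | a :: w => (marks M w).map (consLeft a) ∪ if a = M then {([], w)} else ∅

theorem mem_cuts {M : ℕ} {w x y : List ℕ} :
    (x, y) ∈ cuts M w ↔ x ++ y = w ∧ ∀ c ∈ y.head?, c = M := by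
  induction w generalizing x with
  | nil =>
    simp only [cuts, Finset.mem_singleton, Prod.mk.injEq, List.append_eq_nil_iff]
    constructor
    · rintro ⟨rfl, rfl⟩; simp
    · exact fun h => h.1
  | cons a w ih =>
    simp only [cuts, Finset.mem_union, Finset.mem_map, Prod.exists]
    cases x with
    | nil =>
      by_cases h : a = M
      · subst h
        simp only [consLeft_apply, if_true, Finset.mem_singleton, Prod.mk.injEq, reduceCtorEq,
          false_and, and_false, exists_false, false_or, true_and, List.nil_append]
        exact ⟨fun h => ⟨h, by simp [h]⟩, fun h => h.1⟩
      · simp only [consLeft_apply, if_neg h, Prod.mk.injEq, reduceCtorEq, false_and, and_false,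
          exists_false, false_or, Finset.notMem_empty, List.nil_append, false_iff]
        rintro ⟨rfl, hc⟩
        exact h (by simpa using hc)
    | cons b x =>
      have h : (b :: x, y) ∉ if a = M then {([], a :: w)} else (∅ : Finset (List ℕ × List ℕ)) := by
        split_ifs <;> simp
      simp only [h, or_false, consLeft_apply, Prod.mk.injEq, List.cons.injEq, List.cons_append]
      constructor
      · rintro ⟨x', y', hm, ⟨rfl, rfl⟩, rfl⟩
        have := ih.1 hm
        exact ⟨⟨rfl, this.1⟩, this.2⟩
      · rintro ⟨⟨rfl, hw⟩, hy⟩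
        exact ⟨x, y, ih.2 ⟨hw, hy⟩, ⟨rfl, rfl⟩, rfl⟩

theorem mem_marks {M : ℕ} {w x y : List ℕ} : (x, y) ∈ marks M w ↔ x ++ M :: y = w := by
  induction w generalizing x with
  | nil => simp [marks]
  | cons a w ih =>
    simp only [marks, Finset.mem_union, Finset.mem_map, Prod.exists]
    cases x with
    | nil =>
      by_cases h : a = M
      · subst h; simp [consLeft_apply, eq_comm]
      · have h' : M ≠ a := fun hc => h hc.symm
        simp [consLeft_apply, h, h']
    | cons b x =>
      have h : (b :: x, y) ∉ if a = M then {([], w)} else (∅ : Finset (List ℕ × List ℕ)) := by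
        split_ifs <;> simp
      simp only [h, or_false, consLeft_apply, Prod.mk.injEq, List.cons.injEq, List.cons_append]
      constructor
      · rintro ⟨x', y', hm, ⟨rfl, rfl⟩, rfl⟩
        exact ⟨rfl, ih.1 hm⟩
      · rintro ⟨rfl, hw⟩
        exact ⟨x, y, ih.2 hw, ⟨rfl, rfl⟩, rfl⟩

theorem disjoint_consLeft (a : ℕ) (s : Finset (List ℕ × List ℕ)) (y : List ℕ) :
    Disjoint (s.map (consLeft a)) {([], y)} := by
  simp [consLeft_apply]

/-- The cut points are those just before each M and the one at the end, so each possible number of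
M's on the left occurs exactly once. -/
theorem sum_cuts {R : Type*} [AddCommMonoid R] (M : ℕ) (w : List ℕ) (f : ℕ → ℕ → R) :
    ∑ z ∈ cuts M w, f (z.1.count M) (z.2.count M)
      = ∑ i ∈ Finset.range (w.count M + 1), f i (w.count M - i) := by
  induction w generalizing f with
  | nil => simp [cuts]
  | cons a w ih =>
    by_cases h : a = M
    · subst h
      rw [cuts, if_pos rfl, Finset.sum_union (disjoint_consLeft _ _ _), Finset.sum_map,
        Finset.sum_singleton, List.count_cons_self, Finset.sum_range_succ' _ (_ + 1)]
      simp only [consLeft_apply, List.count_cons_self, List.count_nil,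
        Nat.add_sub_add_right, Nat.sub_zero]
      rw [ih fun i j => f (i + 1) j]
    · rw [cuts, if_neg h, Finset.union_empty, Finset.sum_map, List.count_cons_of_ne h]
      simp only [consLeft_apply, List.count_cons_of_ne h]
      rw [ih]

theorem sum_marks {R : Type*} [AddCommMonoid R] (M : ℕ) (w : List ℕ) (f : ℕ → ℕ → R) :
    ∑ z ∈ marks M w, f (z.1.count M) (z.2.count M)
      = ∑ i ∈ Finset.range (w.count M), f i (w.count M - 1 - i) := by
  induction w generalizing f with
  | nil => simp [marks]
  | cons a w ih =>
    by_cases h : a = M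
    · subst h
      rw [marks, if_pos rfl, Finset.sum_union (disjoint_consLeft _ _ _), Finset.sum_map,
        Finset.sum_singleton, List.count_cons_self, Finset.sum_range_succ']
      simp only [consLeft_apply, List.count_cons_self, List.count_nil,
        Nat.add_sub_cancel, Nat.sub_zero]
      rw [ih fun i j => f (i + 1) j]
      simp only [Nat.sub_sub, add_comm]
    · rw [marks, if_neg h, Finset.union_empty, Finset.sum_map, List.count_cons_of_ne h]
      simp only [consLeft_apply, List.count_cons_of_ne h]
      rw [ih]

end Cuts

/-! ### Removing the largest ordinary letter -/

section Bijections

variable {R : Type*} [CommRing R]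

theorem pqBracket_succ (p q x : R) (h : ℕ) :
    pqBracket p q x (h + 1)
      = ∑ i ∈ Finset.range (h + 1), (if i = 0 then x else 1) * p ^ (h - i) * q ^ i := by
  rw [pqBracket, Finset.range_eq_Ico, Finset.sum_eq_sum_Ico_succ_bot (Nat.succ_pos h)]
  simp only [if_true, Nat.sub_zero, pow_zero, mul_one, Nat.add_sub_cancel, zero_add]
  congr 1
  refine Finset.sum_congr rfl fun i hi => ?_
  rw [if_neg (by have := Finset.mem_Ico.1 hi; omega), one_mul]

open Classical in
/-- The good words with letters `1, …, v` and `h` letters `M`. -/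
noncomputable def goodWords (v h M : ℕ) : Finset (List ℕ) :=
  (List.range' 1 v ++ List.replicate h M).permutations.toFinset.filter (IsGood M)

variable {v h M : ℕ}

theorem mem_goodWords {w : List ℕ} :
    w ∈ goodWords v h M ↔ w.Perm (List.range' 1 v ++ List.replicate h M) ∧ IsGood M w := by
  simp [goodWords]

theorem isLetter_of_perm {w : List ℕ}
    (hw : w.Perm (List.range' 1 v ++ List.replicate h M)) : ∀ c ∈ w, IsLetter v M c := by
  intro c hc
  have := hw.mem_iff.1 hc
  simp only [List.mem_append, List.mem_range'_1, List.mem_replicate] at this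
  simp only [IsLetter]
  omega

theorem count_of_perm (hM : v < M) {w : List ℕ}
    (hw : w.Perm (List.range' 1 v ++ List.replicate h M)) : w.count M = h := by
  rw [hw.count_eq, List.count_append, List.count_replicate_self, List.count_eq_zero.2, zero_add]
  simp only [List.mem_range'_1]
  omega

theorem succ_notMem (hM : v + 1 < M) {w : List ℕ} (hw : ∀ c ∈ w, IsLetter v M c) :
    v + 1 ∉ w := fun hc => by
  have := hw _ hc
  simp only [IsLetter] at this
  omega

theorem perm_range'_succ {w : List ℕ} :
    ((v + 1) :: w).Perm (List.range' 1 (v + 1) ++ List.replicate h M)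
      ↔ w.Perm (List.range' 1 v ++ List.replicate h M) := by
  rw [List.range'_concat, one_mul, add_comm 1 v, List.append_assoc]
  constructor
  · intro hp
    exact (List.perm_cons _).1 (hp.trans (List.perm_middle (l₂ := List.replicate h M)))
  · intro hp
    exact ((List.perm_cons _).2 hp).trans (List.perm_middle (l₂ := List.replicate h M)).symm

theorem perm_insert {x y : List ℕ} :
    (x ++ (v + 1) :: y).Perm (List.range' 1 (v + 1) ++ List.replicate h M)
      ↔ (x ++ y).Perm (List.range' 1 v ++ List.replicate h M) := by
  rw [← perm_range'_succ (w := x ++ y)]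
  exact List.perm_middle.congr_left _

theorem perm_replicate_succ {x y : List ℕ} :
    (x ++ M :: y).Perm (List.range' 1 v ++ List.replicate (h + 1) M)
      ↔ (x ++ y).Perm (List.range' 1 v ++ List.replicate h M) := by
  rw [List.replicate_succ, List.perm_middle.congr_left, List.perm_middle.congr_right,
    List.perm_cons]

theorem append_cons_inj {u : ℕ} {x y x' y' : List ℕ} (hx : u ∉ x) (hx' : u ∉ x')
    (h : x ++ u :: y = x' ++ u :: y') : x = x' ∧ y = y' := by
  induction x generalizing x' with
  | nil =>
    cases x' with
    | nil => simpa using h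
    | cons b x' => simp at h hx'; exact absurd h.1 hx'.1
  | cons a x ih =>
    cases x' with
    | nil => simp at h hx; exact absurd h.1.symm hx.1
    | cons b x' =>
      simp only [List.cons_append, List.cons.injEq] at h
      have := ih (fun hm => hx (by simp [hm])) (fun hm => hx' (by simp [hm])) h.2
      exact ⟨by rw [h.1, this.1], this.2⟩

theorem exists_eq_insert (hM : v + 1 < M) {w : List ℕ}
    (hw : w.Perm (List.range' 1 (v + 1) ++ List.replicate h M)) :
    ∃ x y, w = x ++ (v + 1) :: y ∧ (x ++ y).Perm (List.range' 1 v ++ List.replicate h M)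
      ∧ v + 1 ∉ x ∧ v + 1 ∉ y := by
  have hm : v + 1 ∈ w := hw.mem_iff.2 (by simp)
  obtain ⟨x, y, rfl⟩ := List.append_of_mem hm
  rw [perm_insert] at hw
  have := succ_notMem hM (isLetter_of_perm hw)
  rw [List.mem_append, not_or] at this
  exact ⟨x, y, rfl, hw, this.1, this.2⟩

open Classical in
/-- The weighted sum over the good words with letters `1, …, v` and `h` letters `M` that
satisfy `Q`. -/
noncomputable def goodSum (a abar p q t : R) (v h M : ℕ) (Q : List ℕ → Prop) : R :=
  ∑ w ∈ goodWords v h M with Q w, wordWeight a abar p q t M w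

theorem goodSum_congr (a abar p q t : R) {Q Q' : List ℕ → Prop}
    (hQ : ∀ w ∈ goodWords v h M, (Q w ↔ Q' w)) :
    goodSum a abar p q t v h M Q = goodSum a abar p q t v h M Q' := by
  classical
  rw [goodSum, goodSum, Finset.filter_congr hQ]

theorem goodSum_eq_zero (a abar p q t : R) {Q : List ℕ → Prop}
    (hQ : ∀ w ∈ goodWords v h M, ¬ Q w) : goodSum a abar p q t v h M Q = 0 := by
  classical
  rw [goodSum, Finset.filter_false_of_mem hQ, Finset.sum_empty]

theorem goodSum_eq_add (a abar p q t : R) (Q P : List ℕ → Prop) :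
    goodSum a abar p q t v h M Q = goodSum a abar p q t v h M (fun w => P w ∧ Q w)
      + goodSum a abar p q t v h M (fun w => ¬ P w ∧ Q w) := by
  classical
  simp only [goodSum, Finset.sum_filter, ← Finset.sum_add_distrib]
  refine Finset.sum_congr rfl fun w _ => ?_
  by_cases hP : P w <;> simp [hP]

-- Such a v + 1 has a predecessor at most v, if any, and a successor M, if any. Deleting it leaves a
-- good word together with a cut. The predicate Q carries the conditions on smaller letters, which
-- the deletion must respect.
open Classical in
theorem goodSum_level (a abar p q t : R) (hM : v + 1 < M) (Q : List ℕ → Prop)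
    (hQ : ∀ x y, (∀ c ∈ x.getLast?, c ≤ v) → (∀ c ∈ y.head?, c = M) →
      (Q (x ++ (v + 1) :: y) ↔ Q (x ++ y))) :
    goodSum a abar p q t (v + 1) h M (fun w => NoBottom (v + 1) w ∧ NoTop (v + 1) w ∧ Q w)
      = pqBracket p q (if Even (v + 1) then a else abar) (h + 1)
        * goodSum a abar p q t v h M Q := by
  have key : ∀ w ∈ (goodWords v h M).filter Q,
      ∑ z ∈ cuts M w, wordWeight a abar p q t M (z.1 ++ (v + 1) :: z.2)
        = pqBracket p q (if Even (v + 1) then a else abar) (h + 1)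
          * wordWeight a abar p q t M w := by
    intro w hw
    obtain ⟨hp, hg⟩ := mem_goodWords.1 (Finset.mem_filter.1 hw).1
    rw [pqBracket_succ, ← count_of_perm (by omega) hp, ← sum_cuts M w
      (fun i j => (if i = 0 then (if Even (v + 1) then a else abar) else 1) * p ^ j * q ^ i),
      Finset.sum_mul]
    refine Finset.sum_congr rfl fun z hz => ?_
    obtain ⟨hz1, hz2⟩ := mem_cuts.1 hz
    have hl := isLetter_of_perm hp
    rw [← hz1] at hg hl ⊢
    exact wordWeight_level a abar p q t hM (fun c hc => hl c (by simp [hc]))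
      (fun c hc => hl c (by simp [hc])) hz2 hg
  -- The sum now runs over pairs of a word and one of its cuts, to be matched with the words
  -- containing v + 1.
  rw [goodSum, goodSum, Finset.mul_sum, ← Finset.sum_congr rfl key, Finset.sum_sigma']
  symm
  refine Finset.sum_nbij (fun z => z.2.1 ++ (v + 1) :: z.2.2) ?_ ?_ ?_ fun _ _ => rfl
  · rintro ⟨w, x, y⟩ hz
    simp only [Finset.mem_sigma, Finset.mem_filter, mem_goodWords, mem_cuts] at hz ⊢
    obtain ⟨⟨⟨hp, hg⟩, hq⟩, rfl, hy⟩ := hz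
    have hl := isLetter_of_perm hp
    have hx := hg.getLast_le (fun c hc => hl c (by simp [hc])) hy
    have hn := succ_notMem hM hl
    rw [List.mem_append, not_or] at hn
    refine ⟨⟨perm_insert.2 hp, (isGood_level hM hx hy).2 hg⟩, (noBottom_iff hn.1 hn.2).2 ?_,
      (noTop_iff hn.1 hn.2).2 ?_, (hQ x y hx hy).2 hq⟩
    · exact fun c hc => (hx c hc).trans (Nat.le_succ v)
    · exact fun c hc => (hy c hc).symm ▸ hM.le
  · rintro ⟨w, x, y⟩ hz ⟨w', x', y'⟩ hz' he
    simp only [Finset.coe_sigma, Set.mem_sigma_iff, Finset.mem_coe, Finset.mem_filter,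
      mem_goodWords, mem_cuts] at hz hz'
    obtain ⟨⟨⟨hp, hg⟩, hq⟩, rfl, hy⟩ := hz
    obtain ⟨⟨⟨hp', hg'⟩, hq'⟩, rfl, hy'⟩ := hz'
    have hn := succ_notMem hM (isLetter_of_perm hp)
    have hn' := succ_notMem hM (isLetter_of_perm hp')
    rw [List.mem_append, not_or] at hn hn'
    obtain ⟨rfl, rfl⟩ := append_cons_inj hn.1 hn'.1 he
    rfl
  · intro w hw
    simp only [Finset.coe_filter, Set.mem_ofPred_eq, mem_goodWords] at hw
    obtain ⟨⟨hp, hg⟩, hb, ht, hq⟩ := hw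
    obtain ⟨x, y, rfl, hp, hnx, hny⟩ := exists_eq_insert hM hp
    rw [noBottom_iff hnx hny] at hb
    rw [noTop_iff hnx hny] at ht
    have hl := isLetter_of_perm hp
    have hx : ∀ c ∈ x.getLast?, c ≤ v := fun c hc => by
      have h1 := hb c hc
      have h2 := hl c (by simp [List.mem_of_getLast? hc])
      simp only [IsLetter] at h2
      have h3 : c ≠ v + 1 := fun h => hnx (h ▸ List.mem_of_getLast? hc)
      omega
    have hy : ∀ c ∈ y.head?, c = M := fun c hc => by
      have h1 := ht c hc
      have h2 := hl c (by simp [List.mem_of_head? hc])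
      simp only [IsLetter] at h2
      omega
    refine ⟨⟨x ++ y, x, y⟩, ?_, rfl⟩
    simp only [Finset.coe_sigma, Set.mem_sigma_iff, Finset.mem_coe, Finset.mem_filter,
      mem_goodWords, mem_cuts]
    exact ⟨⟨⟨hp, (isGood_level hM hx hy).1 hg⟩, (hQ x y hx hy).1 hq⟩, trivial, hy⟩

-- The only letter larger than v + 1 is M, so M precedes it; being odd, v + 1 is no descent top, so
-- it is last or followed by M. Deleting the pair M, v + 1 leaves a cut of a word with one M fewer.
open Classical in
theorem goodSum_up (a abar p q t : R) (hM : v + 1 < M) (hMe : Even M) (hv : Odd (v + 1))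
    (Q : List ℕ → Prop)
    (hQ : ∀ x y, (∀ c ∈ x.getLast?, c ≤ v) → (∀ c ∈ y.head?, c = M) →
      (Q (x ++ M :: (v + 1) :: y) ↔ Q (x ++ y))) :
    goodSum a abar p q t (v + 1) (h + 1) M (fun w => ¬ NoBottom (v + 1) w ∧ Q w)
      = t * pqBracket p q 1 (h + 1)
        * goodSum a abar p q t v h M Q := by
  have key : ∀ w ∈ (goodWords v h M).filter Q,
      ∑ z ∈ cuts M w, wordWeight a abar p q t M (z.1 ++ M :: (v + 1) :: z.2)
        = t * pqBracket p q 1 (h + 1) * wordWeight a abar p q t M w := by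
    intro w hw
    obtain ⟨hp, hg⟩ := mem_goodWords.1 (Finset.mem_filter.1 hw).1
    rw [pqBracket_succ, ← count_of_perm (by omega) hp, Finset.mul_sum, ← sum_cuts M w
      (fun i j => t * ((if i = 0 then (1 : R) else 1) * p ^ j * q ^ i)),
      Finset.sum_mul]
    refine Finset.sum_congr rfl fun z hz => ?_
    obtain ⟨hz1, hz2⟩ := mem_cuts.1 hz
    have hl := isLetter_of_perm hp
    rw [← hz1] at hg hl ⊢
    rw [wordWeight_up a abar p q t hM (fun c hc => hl c (by simp [hc]))
      (fun c hc => hl c (by simp [hc])) hz2 hg, ite_self, one_mul, mul_assoc t]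
  rw [goodSum, goodSum, Finset.mul_sum, ← Finset.sum_congr rfl key, Finset.sum_sigma']
  symm
  refine Finset.sum_nbij (fun z => z.2.1 ++ M :: (v + 1) :: z.2.2) ?_ ?_ ?_ fun _ _ => rfl
  · rintro ⟨w, x, y⟩ hz
    simp only [Finset.mem_sigma, Finset.mem_filter, mem_goodWords, mem_cuts] at hz ⊢
    obtain ⟨⟨⟨hp, hg⟩, hq⟩, rfl, hy⟩ := hz
    have hl := isLetter_of_perm hp
    have hx := hg.getLast_le (fun c hc => hl c (by simp [hc])) hy
    have hn := succ_notMem hM hl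
    rw [List.mem_append, not_or] at hn
    refine ⟨⟨perm_replicate_succ.2 (perm_insert.2 hp), (isGood_up hM hMe hv hx hy).2 hg⟩, ?_,
      (hQ x y hx hy).2 hq⟩
    rw [List.append_cons, noBottom_iff _ hn.2]
    · simpa using hM
    · simp only [List.mem_append, List.mem_singleton, not_or]
      exact ⟨hn.1, by omega⟩
  · rintro ⟨w, x, y⟩ hz ⟨w', x', y'⟩ hz' he
    simp only [Finset.coe_sigma, Set.mem_sigma_iff, Finset.mem_coe, Finset.mem_filter,
      mem_goodWords, mem_cuts] at hz hz'
    obtain ⟨⟨⟨hp, hg⟩, hq⟩, rfl, hy⟩ := hz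
    obtain ⟨⟨⟨hp', hg'⟩, hq'⟩, rfl, hy'⟩ := hz'
    have hn := succ_notMem hM (isLetter_of_perm hp)
    have hn' := succ_notMem hM (isLetter_of_perm hp')
    rw [List.mem_append, not_or] at hn hn'
    simp only at he
    -- The unique v + 1 determines the cut; the M in front of it is cancelled afterwards.
    rw [List.append_cons, List.append_cons x'] at he
    have hne : v + 1 ≠ M := by omega
    obtain ⟨h1, rfl⟩ := append_cons_inj (by simp [hn.1, hne]) (by simp [hn'.1, hne]) he
    obtain rfl := List.append_cancel_right h1
    rfl
  · intro w hw
    simp only [Finset.coe_filter, Set.mem_ofPred_eq, mem_goodWords] at hw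
    obtain ⟨⟨hp, hg⟩, hb, hq⟩ := hw
    obtain ⟨x, y, rfl, hp, hnx, hny⟩ := exists_eq_insert hM hp
    rw [noBottom_iff hnx hny] at hb
    push Not at hb
    obtain ⟨c, hc, hvc⟩ := hb
    have hl := isLetter_of_perm hp
    obtain rfl : c = M := by
      have h2 := hl c (by simp [List.mem_of_getLast? hc])
      simp only [IsLetter] at h2
      omega
    obtain ⟨x, rfl⟩ := List.getLast?_eq_some_iff.1 hc
    rw [List.append_assoc, List.singleton_append] at hp hg hq
    rw [perm_replicate_succ] at hp
    have hl := isLetter_of_perm hp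
    have hy : ∀ d ∈ y.head?, d = c := fun d hd => by
      have h2 := hl d (by simp [List.mem_of_head? hd])
      by_contra hdc
      rw [List.append_cons, List.append_cons] at hg
      have h3 := ((adjCount_append_eq_zero _ _ _).1 hg.1).2.2 (v + 1) (by simp) d hd
      have h4 : ¬ Even (v + 1) := by simpa using hv
      simp only [IsLetter] at h2
      exact h3 (Or.inl ⟨by omega, fun h => h4 h.1⟩)
    have hx : ∀ d ∈ x.getLast?, d ≤ v :=
      hg.getLast_le (fun d hd => hl d (by simp [hd])) (by simp)
    refine ⟨⟨x ++ y, x, y⟩, ?_, by simp⟩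
    simp only [Finset.coe_sigma, Set.mem_sigma_iff, Finset.mem_coe, Finset.mem_filter,
      mem_goodWords, mem_cuts]
    exact ⟨⟨⟨hp, (isGood_up hM hMe hv hx hy).1 hg⟩, (hQ x y hx hy).1 hq⟩, trivial, hy⟩

-- Being even, v + 1 is no descent bottom, so both its neighbours are at most v, and an M put in its
-- place is isolated.
open Classical in
theorem goodSum_down (a abar p q t : R) (hM : v + 1 < M) (hMe : Even M)
    (hv : Even (v + 1)) (Q : List ℕ → Prop)
    (hQ : ∀ x y, (∀ c ∈ x.getLast?, c ≤ v) → (∀ c ∈ y.head?, c ≤ v) →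
      (Q (x ++ (v + 1) :: y) ↔ Q (x ++ M :: y))) :
    goodSum a abar p q t (v + 1) h M (fun w => ¬ NoTop (v + 1) w ∧ Q w)
      = pqBracket p q a (h + 1)
        * goodSum a abar p q t v (h + 1) M Q := by
  have key : ∀ w ∈ (goodWords v (h + 1) M).filter Q,
      ∑ z ∈ marks M w, wordWeight a abar p q t M (z.1 ++ (v + 1) :: z.2)
        = pqBracket p q a (h + 1) * wordWeight a abar p q t M w := by
    intro w hw
    obtain ⟨hp, hg⟩ := mem_goodWords.1 (Finset.mem_filter.1 hw).1
    have hs := sum_marks M w (fun i j => (if i = 0 then a else 1) * p ^ j * q ^ i)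
    rw [count_of_perm (by omega) hp] at hs
    simp only [Nat.add_sub_cancel] at hs
    rw [pqBracket_succ, ← hs, Finset.sum_mul]
    refine Finset.sum_congr rfl fun z hz => ?_
    have hz1 := mem_marks.1 hz
    have hl := isLetter_of_perm hp
    rw [← hz1] at hg hl ⊢
    exact wordWeight_down a abar p q t hM hv (fun c hc => hl c (by simp [hc]))
      (fun c hc => hl c (by simp [hc])) hg
  rw [goodSum, goodSum, Finset.mul_sum, ← Finset.sum_congr rfl key, Finset.sum_sigma']
  symm
  refine Finset.sum_nbij (fun z => z.2.1 ++ (v + 1) :: z.2.2) ?_ ?_ ?_ fun _ _ => rfl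
  · rintro ⟨w, x, y⟩ hz
    simp only [Finset.mem_sigma, Finset.mem_filter, mem_goodWords, mem_marks] at hz ⊢
    obtain ⟨⟨⟨hp, hg⟩, hq⟩, rfl⟩ := hz
    have hl := isLetter_of_perm hp
    have hx := hg.getLast_le (fun c hc => hl c (by simp [hc])) (by simp)
    have hy := hg.head_le (fun c hc => hl c (by simp [hc]))
    have hne : y ≠ [] := by
      rintro rfl
      exact hg.2 (by simp)
    have hn := succ_notMem hM hl
    simp only [List.mem_append, List.mem_cons, not_or] at hn
    refine ⟨⟨perm_insert.2 (perm_replicate_succ.1 hp),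
      (isGood_down hM hMe hv hx hy hne).2 hg⟩, ?_, (hQ x y hx hy).2 hq⟩
    rw [noTop_iff hn.1 hn.2.2]
    cases y with
    | nil => exact absurd rfl hne
    | cons d y =>
      simp at hy ⊢
      exact hy
  · rintro ⟨w, x, y⟩ hz ⟨w', x', y'⟩ hz' he
    simp only [Finset.coe_sigma, Set.mem_sigma_iff, Finset.mem_coe, Finset.mem_filter,
      mem_goodWords, mem_marks] at hz hz'
    obtain ⟨⟨⟨hp, hg⟩, hq⟩, rfl⟩ := hz
    obtain ⟨⟨⟨hp', hg'⟩, hq'⟩, rfl⟩ := hz'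
    have hn := succ_notMem hM (isLetter_of_perm hp)
    have hn' := succ_notMem hM (isLetter_of_perm hp')
    rw [List.mem_append, not_or] at hn hn'
    obtain ⟨rfl, rfl⟩ := append_cons_inj hn.1 hn'.1 he
    rfl
  · intro w hw
    simp only [Finset.coe_filter, Set.mem_ofPred_eq, mem_goodWords] at hw
    obtain ⟨⟨hp, hg⟩, ht, hq⟩ := hw
    obtain ⟨x, y, rfl, hp, hnx, hny⟩ := exists_eq_insert hM hp
    rw [noTop_iff hnx hny] at ht
    push Not at ht
    obtain ⟨c, hc, hvc⟩ := ht
    have hy : ∀ d ∈ y.head?, d ≤ v := fun d hd => by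
      obtain rfl : c = d := Option.mem_unique hc hd
      omega
    have hne : y ≠ [] := by
      rintro rfl
      simp at hc
    have hl := isLetter_of_perm hp
    have hx : ∀ d ∈ x.getLast?, d ≤ v := fun d hd => by
      have h2 := hl d (by simp [List.mem_of_getLast? hd])
      have h3 := ((adjCount_append_eq_zero _ _ _).1 hg.1).2.2 d hd (v + 1) (by simp)
      have h4 : ¬ Odd (v + 1) := by simpa using hv
      simp only [IsLetter] at h2
      by_contra hdv
      exact h3 (Or.inl ⟨by omega, fun h => h4 h.2⟩)
    refine ⟨⟨x ++ M :: y, x, y⟩, ?_, by simp⟩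
    simp only [Finset.coe_sigma, Set.mem_sigma_iff, Finset.mem_coe, Finset.mem_filter,
      mem_goodWords, mem_marks]
    exact ⟨⟨⟨perm_replicate_succ.2 hp, (isGood_down hM hMe hv hx hy hne).1 hg⟩,
      (hQ x y hx hy).1 hq⟩, trivial⟩

end Bijections

/-! ### Two letters at a time: the Motzkin recursion -/

section Recursion

variable {R : Type*} [CommRing R] {v h M u : ℕ}

theorem noBottom_level (hM : v + 1 < M) (hu : u ≤ v) {x y : List ℕ}
    (hx : ∀ c ∈ x.getLast?, c ≤ v) (hy : ∀ c ∈ y.head?, c = M) :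
    NoBottom u (x ++ (v + 1) :: y) ↔ NoBottom u (x ++ y) := by
  rw [NoBottom, adjCount_level _ (by omega) (by omega) (by omega) hx hy]

theorem noTop_level (hM : v + 1 < M) (hu : u ≤ v) {x y : List ℕ}
    (hx : ∀ c ∈ x.getLast?, c ≤ v) (hy : ∀ c ∈ y.head?, c = M) :
    NoTop u (x ++ (v + 1) :: y) ↔ NoTop u (x ++ y) := by
  rw [NoTop, adjCount_level _ (by omega) (by omega) (by omega) hx hy]

theorem noBottom_up (hM : v + 1 < M) (hu : u ≤ v) {x y : List ℕ}
    (hx : ∀ c ∈ x.getLast?, c ≤ v) (hy : ∀ c ∈ y.head?, c = M) :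
    NoBottom u (x ++ M :: (v + 1) :: y) ↔ NoBottom u (x ++ y) := by
  rw [NoBottom, adjCount_up _ (by omega) (by omega) hx hy, if_neg (by omega), add_zero]

theorem noTop_up (hM : v + 1 < M) (hu : u ≤ v) {x y : List ℕ}
    (hx : ∀ c ∈ x.getLast?, c ≤ v) (hy : ∀ c ∈ y.head?, c = M) :
    NoTop u (x ++ M :: (v + 1) :: y) ↔ NoTop u (x ++ y) := by
  rw [NoTop, adjCount_up _ (by omega) (by omega) hx hy, if_neg (by omega), add_zero]

theorem noBottom_down (hM : v + 1 < M) (hu : u ≤ v) {x y : List ℕ}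
    (hx : ∀ c ∈ x.getLast?, c ≤ v) (hy : ∀ c ∈ y.head?, c ≤ v) :
    NoBottom u (x ++ (v + 1) :: y) ↔ NoBottom u (x ++ M :: y) := by
  rw [NoBottom, adjCount_down (M := M) (v := v) _ (by omega) (by omega) (by omega) hx hy]

theorem noTop_down (hM : v + 1 < M) (hu : u ≤ v) {x y : List ℕ}
    (hx : ∀ c ∈ x.getLast?, c ≤ v) (hy : ∀ c ∈ y.head?, c ≤ v) :
    NoTop u (x ++ (v + 1) :: y) ↔ NoTop u (x ++ M :: y) := by
  rw [NoTop, adjCount_down (M := M) (v := v) _ (by omega) (by omega) (by omega) hx hy]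

theorem IsGood.noBottom {w : List ℕ} (hw : IsGood M w) (hu : Even u) : NoBottom u w := by
  have h := hw.1
  rw [adjCount_eq_zero_iff_isChain] at h
  rw [NoBottom, adjCount_eq_zero_iff_isChain]
  refine h.imp fun a b hab hc => hab (Or.inl ⟨by omega, fun ho => ?_⟩)
  rw [hc.1] at ho
  exact Nat.not_odd_iff_even.2 hu ho.2

theorem IsGood.noTop {w : List ℕ} (hw : IsGood M w) (hu : Odd u) : NoTop u w := by
  have h := hw.1
  rw [adjCount_eq_zero_iff_isChain] at h
  rw [NoTop, adjCount_eq_zero_iff_isChain]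
  refine h.imp fun a b hab hc => hab (Or.inl ⟨by omega, fun ho => ?_⟩)
  rw [hc.1] at ho
  exact Nat.not_even_iff_odd.2 hu ho.1

/-- For no `i < j` the letters `2i+1` and `2i+2` are a descent bottom and a descent top. -/
def IsSeparated (j : ℕ) (w : List ℕ) : Prop :=
  ∀ i < j, NoBottom (2 * i + 1) w ∨ NoTop (2 * i + 2) w

theorem isSeparated_succ {j : ℕ} {w : List ℕ} :
    IsSeparated (j + 1) w
      ↔ IsSeparated j w ∧ (NoBottom (2 * j + 1) w ∨ NoTop (2 * j + 2) w) := by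
  simp only [IsSeparated, Nat.forall_lt_succ_right]

theorem isSeparated_congr {j : ℕ} {w w' : List ℕ} (hj : 2 * j ≤ v)
    (h : ∀ u ≤ v, (NoBottom u w ↔ NoBottom u w') ∧ (NoTop u w ↔ NoTop u w')) :
    IsSeparated j w ↔ IsSeparated j w' :=
  forall₂_congr fun i hi =>
    or_congr (h (2 * i + 1) (by omega)).1 (h (2 * i + 2) (by omega)).2

theorem goodSum_zero (a abar p q t : R) (h M : ℕ) :
    goodSum a abar p q t 0 h M (IsSeparated 0) = if h = 0 then 1 else 0 := by
  classical
  cases h with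
  | zero =>
    have : goodWords 0 0 M = {[]} := by
      ext w
      simp only [mem_goodWords, Finset.mem_singleton]
      constructor
      · intro hw; simpa using hw.1
      · rintro rfl; simp [IsGood, adjCount]
    have h0 : IsSeparated 0 [] := fun i hi => absurd hi (Nat.not_lt_zero i)
    rw [goodSum, this, Finset.filter_singleton, if_pos h0]
    simp [wordWeight, lrMaxCount, wordRes, wordLes, wordDes, adjCount]
  | succ h =>
    rw [if_neg (Nat.succ_ne_zero h)]
    -- A nonempty word made only of M's ends in M, hence is not good.
    refine goodSum_eq_zero a abar p q t fun w hw _ => ?_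
    obtain ⟨hp, hg⟩ := mem_goodWords.1 hw
    have : w = List.replicate (h + 1) M := List.perm_replicate.1 (by simpa using hp)
    exact absurd (by simp [this, List.getLast?_replicate]) hg.2

theorem goodSum_odd_noBottom (a abar p q t : R) {j : ℕ} (hM : 2 * j + 2 < M) (h : ℕ) :
    goodSum a abar p q t (2 * j + 1) h M (fun w => NoBottom (2 * j + 1) w ∧ IsSeparated j w)
      = pqBracket p q abar (h + 1) * goodSum a abar p q t (2 * j) h M (IsSeparated j) := by
  have := goodSum_level (h := h) a abar p q t (v := 2 * j) (M := M) (by omega)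
    (IsSeparated j) fun x y hx hy => isSeparated_congr le_rfl fun u hu =>
      ⟨noBottom_level (by omega) hu hx hy, noTop_level (by omega) hu hx hy⟩
  rw [if_neg (by simp)] at this
  rw [← this]
  refine goodSum_congr a abar p q t fun w hw => ?_
  have := (mem_goodWords.1 hw).2.noTop (u := 2 * j + 1) (by simp)
  tauto

theorem goodSum_odd_bottom_succ (a abar p q t : R) {j : ℕ} (hM : 2 * j + 2 < M)
    (hMe : Even M) (h : ℕ) :
    goodSum a abar p q t (2 * j + 1) (h + 1) M
        (fun w => ¬ NoBottom (2 * j + 1) w ∧ IsSeparated j w)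
      = t * pqBracket p q 1 (h + 1) * goodSum a abar p q t (2 * j) h M (IsSeparated j) :=
  goodSum_up a abar p q t (by omega) hMe (by simp) (IsSeparated j) fun x y hx hy =>
    isSeparated_congr le_rfl fun u hu =>
      ⟨noBottom_up (by omega) hu hx hy, noTop_up (by omega) hu hx hy⟩

/-- Without any M, the letter 2j + 1 is the largest and has no larger predecessor. -/
theorem goodSum_odd_bottom_zero (a abar p q t : R) (j M : ℕ) :
    goodSum a abar p q t (2 * j + 1) 0 M
      (fun w => ¬ NoBottom (2 * j + 1) w ∧ IsSeparated j w) = 0 := by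
  refine goodSum_eq_zero a abar p q t fun w hw hb => ?_
  refine absurd (adjCount_eq_zero_of_forall _ fun c hc d hd hcd => ?_) hb.1
  have := (mem_goodWords.1 hw).1.mem_iff.1 hc
  simp only [List.replicate_zero, List.append_nil, List.mem_range'_1] at this
  omega

/-- If 2j + 2 is a top, separation forces 2j + 1 not to be a bottom, leaving only "level, then
down". If 2j + 2 is not a top, separation says nothing about 2j + 1, and both kinds of odd insertion
remain. -/
theorem goodSum_even_succ (a abar p q t : R) {j : ℕ} (hM : 2 * j + 2 < M) (hMe : Even M)
    (h : ℕ) :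
    goodSum a abar p q t (2 * (j + 1)) h M (IsSeparated (j + 1))
      = pqBracket p q a (h + 1) * (pqBracket p q abar (h + 2)
            * goodSum a abar p q t (2 * j) (h + 1) M (IsSeparated j))
        + pqBracket p q a (h + 1)
          * (pqBracket p q abar (h + 1) * goodSum a abar p q t (2 * j) h M (IsSeparated j)
            + goodSum a abar p q t (2 * j + 1) h M
                (fun w => ¬ NoBottom (2 * j + 1) w ∧ IsSeparated j w)) := by
  have hd := goodSum_down (h := h) a abar p q t (v := 2 * j + 1) (M := M) hM hMe
    (by simp [Nat.even_add_one])
    (fun w => NoBottom (2 * j + 1) w ∧ IsSeparated j w) fun x y hx hy =>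
      and_congr (noBottom_down hM le_rfl hx hy) (isSeparated_congr (Nat.le_succ _) fun u hu =>
        ⟨noBottom_down hM hu hx hy, noTop_down hM hu hx hy⟩)
  have hl := goodSum_level (h := h) a abar p q t (v := 2 * j + 1) (M := M) hM
    (IsSeparated j) fun x y hx hy => isSeparated_congr (Nat.le_succ _) fun u hu =>
      ⟨noBottom_level hM hu hx hy, noTop_level hM hu hx hy⟩
  rw [if_pos (by simp [Nat.even_add_one])] at hl
  rw [goodSum_odd_noBottom a abar p q t hM] at hd
  rw [← goodSum_odd_noBottom a abar p q t hM h, ← hd,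
    ← goodSum_eq_add a abar p q t (IsSeparated j) (NoBottom (2 * j + 1)), ← hl,
    goodSum_eq_add a abar p q t _ (fun w => ¬ NoTop (2 * j + 2) w)]
  congr 1
  · refine goodSum_congr a abar p q t fun w _ => ?_
    rw [isSeparated_succ]
    tauto
  · refine goodSum_congr a abar p q t fun w hw => ?_
    -- An even letter is never a descent bottom of a good word, so this condition of the level case
    -- is free.
    have := (mem_goodWords.1 hw).2.noBottom (u := 2 * j + 2) (by simp [Nat.even_add])
    rw [isSeparated_succ]
    tauto

/-- The weighted sum over separated good words enumerates Motzkin paths. -/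
theorem goodSum_eq_motzkin (a abar p q t : R) (hMe : Even M) {j : ℕ} (hM : 2 * j < M)
    (h : ℕ) :
    goodSum a abar p q t (2 * j) h M (IsSeparated j)
      = motzkin (fun n => pqBracket p q a (n + 1) * pqBracket p q abar (n + 1))
        (fun n => t * pqBracket p q 1 (n + 1) * pqBracket p q a (n + 2))
        (fun n => pqBracket p q a (n + 1) * pqBracket p q abar (n + 2)) j h := by
  induction j generalizing h with
  | zero => rw [Nat.mul_zero, goodSum_zero, motzkin]
  | succ j ih =>
    have ih := ih (by omega)
    rw [goodSum_even_succ a abar p q t (by omega) hMe]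
    cases h with
    | zero =>
      rw [goodSum_odd_bottom_zero a abar p q t, ih, ih, motzkin]
      ring
    | succ h =>
      rw [goodSum_odd_bottom_succ a abar p q t (by omega) hMe, ih, ih, ih, motzkin]
      ring

end Recursion

/-! ### Recursive list statistics as sums over positions -/

section OfFn

theorem adjCount_ofFn (r : ℕ → ℕ → Prop) [DecidableRel r] {m : ℕ} (f : Fin m → ℕ) :
    adjCount r (List.ofFn f)
      = ∑ i : Fin m, if ∃ j : Fin m, (i : ℕ) + 1 = j ∧ r (f i) (f j) then 1 else 0 := by
  induction m with
  | zero => simp [adjCount]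
  | succ m ih =>
    cases m with
    | zero => simp [adjCount]
    | succ m =>
      have := ih fun i => f i.succ
      rw [List.ofFn_succ] at this
      rw [List.ofFn_succ, List.ofFn_succ, adjCount, this, Fin.sum_univ_succ (n := m + 1)]
      simp [Fin.exists_fin_succ]
      congr

theorem wordRes_ofFn {m : ℕ} (f : Fin m → ℕ) :
    wordRes (List.ofFn f) = ∑ i : Fin m, ∑ j : Fin m,
      if i < j ∧ ∃ k : Fin m, (j : ℕ) + 1 = k ∧ f i < f j ∧ f k < f i then 1 else 0 := by
  induction m with
  | zero => simp [wordRes]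
  | succ m ih =>
    rw [List.ofFn_succ, wordRes, ih, adjCount_ofFn, Fin.sum_univ_succ]
    simp only [Fin.sum_univ_succ (n := m)]
    simp [Fin.exists_fin_succ, and_comm]

theorem countP_ofFn (P : ℕ → Bool) {m : ℕ} (f : Fin m → ℕ) :
    (List.ofFn f).countP P = ∑ i : Fin m, if P (f i) then 1 else 0 := by
  induction m with
  | zero => simp
  | succ m ih => rw [List.ofFn_succ, List.countP_cons, ih, Fin.sum_univ_succ, add_comm]

theorem wordLes_ofFn {m : ℕ} (f : Fin m → ℕ) :
    wordLes (List.ofFn f) = ∑ i : Fin m, ∑ j : Fin m,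
      if i < j ∧ ∃ k : Fin m, (k : ℕ) + 1 = i ∧ f j < f k ∧ f i < f j then 1 else 0 := by
  induction m with
  | zero => simp [wordLes]
  | succ m ih =>
    cases m with
    | zero => simp [wordLes]
    | succ m =>
      have hle := ih fun i => f i.succ
      rw [List.ofFn_succ] at hle
      -- The predecessor k is either the first position, which forces i = 0, or a successor, which
      -- gives a term of the shorter word.
      have hstep : ∀ i j : Fin (m + 1),
          (if i.succ < j.succ ∧ ∃ k : Fin (m + 2), (k : ℕ) + 1 = i.succ ∧ f j.succ < f k
              ∧ f i.succ < f j.succ then 1 else 0)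
            = (if i = 0 ∧ 0 < j ∧ f (Fin.succ 0) < f j.succ ∧ f j.succ < f 0 then 1 else 0)
              + if i < j ∧ ∃ k : Fin (m + 1), (k : ℕ) + 1 = i ∧ f j.succ < f k.succ
                  ∧ f i.succ < f j.succ then 1 else 0 := by
        intro i j
        simp only [Fin.exists_fin_succ (n := m + 1)]
        by_cases hi : i = 0
        · subst hi
          have hk : ¬ ∃ k : Fin (m + 1), (k : ℕ) + 1 = ((0 : Fin (m + 1)) : ℕ)
              ∧ f j.succ < f k.succ ∧ f (Fin.succ 0) < f j.succ := by simp
          rw [if_neg (c := _ ∧ ∃ k : Fin (m + 1), (k : ℕ) + 1 = ((0 : Fin (m + 1)) : ℕ) ∧ _)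
            (fun h => hk h.2), add_zero]
          refine if_congr ?_ rfl rfl
          rw [Fin.succ_lt_succ_iff]
          simp [and_comm]
        · have hi' : (i : ℕ) ≠ 0 := fun h => hi (Fin.ext h)
          simp [hi, hi', eq_comm]
      rw [List.ofFn_succ, List.ofFn_succ, wordLes, hle, countP_ofFn, Fin.sum_univ_succ (n := m + 1)]
      -- The first position has no predecessor, so its terms vanish.
      rw [Finset.sum_eq_zero (s := Finset.univ (α := Fin (m + 2))) (fun j _ => if_neg (by simp)),
        zero_add]
      simp only [Fin.sum_univ_succ (n := m + 1), Fin.not_lt_zero, false_and, if_false, zero_add,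
        hstep, Finset.sum_add_distrib]
      congr 1
      rw [Fin.sum_univ_succ (n := m), Fin.sum_univ_succ (n := m)]
      simp only [decide_eq_true_eq]
      simp [-Finset.sum_boole]
      congr

theorem lrMaxCount_ofFn (P : ℕ → Prop) [DecidablePred P] (B : ℕ) {m : ℕ} (f : Fin m → ℕ) :
    lrMaxCount P B (List.ofFn f)
      = ∑ i : Fin m, if B < f i ∧ (∀ j < i, f j < f i) ∧ P (f i) then 1 else 0 := by
  induction m generalizing B with
  | zero => simp [lrMaxCount]
  | succ m ih =>
    rw [List.ofFn_succ, lrMaxCount, ih, Fin.sum_univ_succ]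
    simp [Fin.forall_fin_succ, and_assoc]

end OfFn

/-! ### From permutations to words without placeholders -/

section Main

variable {R : Type*} [CommRing R] {n : ℕ}

/-- The word of a permutation. -/
def toWord {m : ℕ} (σ : Equiv.Perm (Fin m)) : List ℕ := List.ofFn (letter σ)

theorem wordDes_toWord {m : ℕ} (σ : Equiv.Perm (Fin m)) : wordDes (toWord σ) = des σ := by
  rw [wordDes, toWord, adjCount_ofFn, des, Finset.card_filter]

theorem wordRes_toWord {m : ℕ} (σ : Equiv.Perm (Fin m)) : wordRes (toWord σ) = res σ := by
  rw [toWord, wordRes_ofFn, res, Finset.card_filter, Fintype.sum_prod_type]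

theorem wordLes_toWord {m : ℕ} (σ : Equiv.Perm (Fin m)) : wordLes (toWord σ) = les σ := by
  rw [toWord, wordLes_ofFn, les, Finset.card_filter, Fintype.sum_prod_type]

theorem lrMaxCount_even_toWord {m M : ℕ} (hM : m < M) (σ : Equiv.Perm (Fin m)) :
    lrMaxCount (fun c => Even c ∧ c < M) 0 (toWord σ) = lema σ := by
  rw [toWord, lrMaxCount_ofFn, lema, Finset.card_filter]
  refine Finset.sum_congr rfl fun i _ => if_congr ?_ rfl rfl
  have h : letter σ i < M := by rw [letter]; omega
  have h' : 0 < letter σ i := Nat.succ_pos _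
  simp [h, h']

theorem lrMaxCount_odd_toWord {m M : ℕ} (hM : m < M) (σ : Equiv.Perm (Fin m)) :
    lrMaxCount (fun c => Odd c ∧ c < M) 0 (toWord σ) = loma σ := by
  rw [toWord, lrMaxCount_ofFn, loma, Finset.card_filter]
  refine Finset.sum_congr rfl fun i _ => if_congr ?_ rfl rfl
  have h : letter σ i < M := by rw [letter]; omega
  have h' : 0 < letter σ i := Nat.succ_pos _
  simp [h, h']

theorem adjCount_toWord_eq_zero (r : ℕ → ℕ → Prop) [DecidableRel r] {m : ℕ}
    (σ : Equiv.Perm (Fin m)) :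
    adjCount r (toWord σ) = 0
      ↔ ∀ i j : Fin m, (i : ℕ) + 1 = j → ¬ r (letter σ i) (letter σ j) := by
  simp [toWord, adjCount_ofFn]

theorem isSeparated_toWord (σ : Equiv.Perm (Fin (2 * n))) :
    IsSeparated n (toWord σ) ↔
      ∀ j ∈ Finset.Icc 1 n, ¬ (IsDescentBottom σ (2 * j - 1) ∧ IsDescentTop σ (2 * j)) := by
  have hb : ∀ u, NoBottom u (toWord σ) ↔ ¬ IsDescentBottom σ u := by
    intro u
    rw [NoBottom, adjCount_toWord_eq_zero]
    simp only [IsDescentBottom, IsDescentAt, not_exists]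
    refine forall₂_congr fun i j => ?_
    constructor
    · rintro h ⟨⟨h1, h2⟩, h3⟩
      exact h h1 ⟨h3, h3 ▸ h2⟩
    · rintro h h1 ⟨h2, h3⟩
      exact h ⟨⟨h1, h2.symm ▸ h3⟩, h2⟩
  have ht : ∀ u, NoTop u (toWord σ) ↔ ¬ IsDescentTop σ u := by
    intro u
    rw [NoTop, adjCount_toWord_eq_zero]
    simp only [IsDescentTop, IsDescentAt, not_exists]
    refine forall₂_congr fun i j => ?_
    constructor
    · rintro h ⟨⟨h1, h2⟩, h3⟩
      exact h h1 ⟨h3, h3 ▸ h2⟩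
    · rintro h h1 ⟨h2, h3⟩
      exact h ⟨⟨h1, h2.symm ▸ h3⟩, h2⟩
  simp only [IsSeparated, hb, ht, not_and_or, Finset.mem_Icc]
  constructor
  · rintro h j ⟨h1, h2⟩
    obtain ⟨i, rfl⟩ := Nat.exists_eq_add_of_le' h1
    exact h i h2
  · exact fun h i hi => h (i + 1) ⟨by omega, hi⟩

theorem isGood_toWord {m M : ℕ} (hM : m < M) (σ : Equiv.Perm (Fin m)) :
    IsGood M (toWord σ) ↔ IsEvenOddDescentPerm σ := by
  have hl : ∀ i, letter σ i < M := fun i => by rw [letter]; omega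
  have h1 : M ∉ (toWord σ).getLast? := by
    intro h
    obtain ⟨i, hi⟩ := List.mem_ofFn.1 (List.mem_of_getLast? h)
    exact (hl i).ne hi
  rw [IsGood, adjCount_toWord_eq_zero]
  refine ⟨fun h i j hd => ?_, fun h => ⟨fun i j hij hb => ?_, h1⟩⟩
  · by_contra hc
    exact h.1 i j hd.1 (Or.inl ⟨hd.2, hc⟩)
  · rcases hb with hb | hb
    · exact hb.2 (h i j ⟨hij, hb.1⟩)
    · exact (hl i).ne hb.1

theorem toWord_injective {m : ℕ} : Function.Injective (toWord (m := m)) := by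
  intro σ τ h
  ext i
  have := congrFun (List.ofFn_injective h) i
  simpa [letter] using this

theorem toWord_perm {m : ℕ} (σ : Equiv.Perm (Fin m)) : (toWord σ).Perm (List.range' 1 m) := by
  rw [List.perm_ext_iff_of_nodup]
  · intro c
    rw [toWord, List.mem_ofFn, List.mem_range'_1]
    constructor
    · rintro ⟨i, rfl⟩
      rw [letter]
      omega
    · rintro ⟨h1, h2⟩
      refine ⟨σ.symm ⟨c - 1, by omega⟩, ?_⟩
      simp [letter, h1]
  · rw [toWord, List.nodup_ofFn]
    intro i j h
    exact σ.injective (Fin.ext (by simpa [letter] using h))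
  · exact List.nodup_range'

theorem exists_toWord_eq {m : ℕ} {w : List ℕ} (hw : w.Perm (List.range' 1 m)) :
    ∃ σ : Equiv.Perm (Fin m), toWord σ = w := by
  have hlen : w.length = m := by simpa using hw.length_eq
  subst hlen
  have hmem : ∀ i : Fin w.length, 1 ≤ w.get i ∧ w.get i < 1 + w.length := fun i => by
    have := hw.mem_iff.1 (List.get_mem w i)
    rwa [List.mem_range'_1] at this
  have hnd : w.Nodup := hw.nodup_iff.2 List.nodup_range'
  let f : Fin w.length → Fin w.length := fun i => ⟨w.get i - 1, by have := hmem i; omega⟩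
  have hf : Function.Injective f := by
    intro i j hij
    have h1 := hmem i
    have h2 := hmem j
    have h3 := Fin.ext_iff.1 hij
    simp only [f] at h3
    exact hnd.injective_get (by omega)
  refine ⟨Equiv.ofBijective f (Finite.injective_iff_bijective.1 hf), ?_⟩
  rw [toWord]
  conv_rhs => rw [← List.ofFn_get w]
  congr 1
  funext i
  have := hmem i
  simp only [letter, Equiv.ofBijective_apply, f]
  omega

/-- With no M present, goodness is just the even-odd condition. The choice 2n + 2 is an even number
above all the letters. -/
theorem ePoly_eq_goodSum (a abar p q t : R) (n : ℕ) :
    ePoly a abar p q t n = goodSum a abar p q t (2 * n) 0 (2 * n + 2) (IsSeparated n) := by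
  classical
  rw [ePoly, goodSum]
  refine Finset.sum_nbij toWord ?_ toWord_injective.injOn ?_ ?_
  · intro σ hσ
    have h := (Finset.mem_filter.1 hσ).2
    rw [Finset.mem_filter, mem_goodWords, isGood_toWord (by omega), isSeparated_toWord]
    exact ⟨⟨by simpa using toWord_perm σ, h.1⟩, h.2⟩
  · intro w hw
    obtain ⟨hw, hs⟩ := Finset.mem_filter.1 hw
    obtain ⟨hp, hg⟩ := mem_goodWords.1 hw
    obtain ⟨σ, rfl⟩ := exists_toWord_eq (by simpa using hp)
    rw [isGood_toWord (by omega)] at hg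
    rw [isSeparated_toWord] at hs
    exact ⟨σ, by simpa using ⟨hg, by simpa using hs⟩, rfl⟩
  · intro σ _
    rw [wordWeight, lrMaxCount_even_toWord (by omega), lrMaxCount_odd_toWord (by omega),
      wordRes_toWord, wordLes_toWord, wordDes_toWord]

end Main

end EPermJFrac

theorem mainTheorem9 {R : Type*} [CommRing R] (a abar p q t : R) :
    EPermJFrac.IsJFraction
      (PowerSeries.mk fun n => if n = 0 then 1 else EPermJFrac.ePoly a abar p q t n)
      (fun n => EPermJFrac.pqBracket p q a (n + 1) * EPermJFrac.pqBracket p q abar (n + 1))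
      (fun n => t * EPermJFrac.pqBracket p q a n * EPermJFrac.pqBracket p q a (n + 1)
        * EPermJFrac.pqBracket p q 1 n * EPermJFrac.pqBracket p q abar (n + 1)) := by
  refine EPermJFrac.isJFraction_of_coeff_eq_motzkin
    -- The indices n + 2 arise because the even letter of an up step comes after the new M, and the
    -- odd letter of a down step comes before an M is removed.
    (up := fun n => t * EPermJFrac.pqBracket p q 1 (n + 1) * EPermJFrac.pqBracket p q a (n + 2))
    (down := fun n => EPermJFrac.pqBracket p q a (n + 1) * EPermJFrac.pqBracket p q abar (n + 2))
    (fun h => by ring) fun n => ?_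
  rw [PowerSeries.coeff_mk]
  split_ifs with hn
  · subst hn
    simp [EPermJFrac.motzkin]
  · rw [EPermJFrac.ePoly_eq_goodSum,
      EPermJFrac.goodSum_eq_motzkin a abar p q t (by simp [Nat.even_add]) (by omega)]
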